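/- Consider the $d$-armed bandit game with $T\ge 1$ rounds. A prior $\nu$, i.e. an arbitrary probability distribution on loss sequences $\ell=(\ell_t(i))_{1\le t\le T,\,1\le i\le d}\in[0,1]^{T\times d}$ (with no independence assumption over rounds or arms), is known to the player, and $\ell$ is drawn from $\nu$. In round $t$ the player picks an arm $a_t\in\{1,\dots,d\}$, suffers the loss $\ell_t(a_t)$ and observes only $\ell_t(a_t)$. Let $$L^*=\min_{i}\sum_{t=1}^T \ell_t(i),\qquad a^*\in\operatorname*{arg\,min}_{i}\sum_{t=1}^T\ell_t(i),\qquad R_T=\sum_{t=1}^T\ell_t(a_t)-L^*,$$ where $a^*$ is a measurable function of $\ell$ (ties may be broken by any measurable rule). Let $p_t$ denote the posterior distribution of $a^*$ given $(a_s,\ell_s(a_s))_{s<t}$; in particular $p_1$ is the distribution of $a^*$ under $\nu$. Thompson Sampling draws $a_t$ from $p_t$, that is, for all $t$ and $i$, $$\mathbb P\big(a_t=i\mid \ell, a_1,\dots,a_{t-1}\big)=p_t(i)\quad\text{almost surely}.$$ For $\alpha\in(0,1)$ the $\alpha$-Tsallis entropy of a probability vector $p$ is $H_\alpha(p)=\dfrac{\left(\sum_i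 p_i^\alpha\right)-1}{\alpha(1-\alpha)}$. **Theorem.** (1) There is a universal constant $C>0$ such that for all $\alpha\in(0,1)$, all $d$, all $T\ge1$, every prior $\nu$ and every real $\underline L^*>0$ with $L^*\le\underline L^*$ almost surely, Thompson Sampling satisfies $$\mathbb E[R_T]\le C\left(\sqrt{H_\alpha(p_1)\,d^\alpha\,\underline L^*}+H_\alpha(p_1)\,d^\alpha+d\log^2(\underline L^*)+d\log T\right).$$ (2) For every $\alpha\in(0,1)$ there is a constant $C_\alpha>0$ depending only on $\alpha$ such that for all $d$, all $T\ge 1$, every prior $\nu$ (whatever $p_1$ is) and every real $\underline L^*>0$ with $L^*\le\underline L^*$ almost surely, Thompson Sampling satisfies $$\mathbb E[R_T]\le C_\alpha\left(\sqrt{d\,\underline L^*}+d\log^2(\underline L^*)+d\log T\right).$$ -/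

import Mathlib

open MeasureTheory ProbabilityTheory
open scoped BigOperators

namespace BanditTS

/-- A sequence of `T` loss vectors for `d` arms; `ℓ t i` is the loss of arm `i` in round `t`. -/
abbrev LossSeq (d T : ℕ) : Type := Fin T → Fin d → ℝ

/-- The cumulative loss of the fixed arm `i`. -/
def armLoss {d T : ℕ} (ℓ : LossSeq d T) (i : Fin d) : ℝ := ∑ t, ℓ t i

/-- `L*`: the cumulative loss of the best fixed arm in hindsight. -/
noncomputable def bestLoss {d T : ℕ} (ℓ : LossSeq d T) : ℝ := ⨅ i, armLoss ℓ i

/-- `ν` is a prior over loss sequences: an arbitrary probability distribution on `[0,1]^{T × d}`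
(no independence over rounds or arms). -/
structure IsPrior {d T : ℕ} (ν : Measure (LossSeq d T)) : Prop where
  prob : IsProbabilityMeasure ν
  mem_cube : ∀ᵐ ℓ ∂ν, ∀ t i, ℓ t i ∈ Set.Icc (0 : ℝ) 1

/-- `best` is a version of the optimal arm `a* = argmin_i ∑_t ℓ_t(i)`: a measurable selection
of a minimiser (an arbitrary rule for breaking ties). -/
structure IsOptimalArm {d T : ℕ} (best : LossSeq d T → Fin d) : Prop where
  measurable : Measurable best
  minimal : ∀ ℓ i, armLoss ℓ (best ℓ) ≤ armLoss ℓ i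

/-- `p_1`: the distribution of the optimal arm under the prior. -/
noncomputable def priorArm {d T : ℕ} (ν : Measure (LossSeq d T)) (best : LossSeq d T → Fin d)
    (i : Fin d) : ℝ := ν.real {ℓ | best ℓ = i}

/-- The `α`-Tsallis entropy of a vector `p` of probabilities. -/
noncomputable def tsallis {d : ℕ} (α : ℝ) (p : Fin d → ℝ) : ℝ :=
  ((∑ i, p i ^ α) - 1) / (α * (1 - α))

section Game

variable {d T : ℕ} {Ω : Type*}

/-- The player's information at the beginning of round `t` under bandit feedback: the
σ-algebra generated by the arms `a_s` played and the losses `ℓ_s(a_s)` observed in the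
rounds `s < t`. -/
abbrev history (ℓ : Ω → LossSeq d T) (a : Fin T → Ω → Fin d) (t : Fin T) : MeasurableSpace Ω :=
  ⨆ (s : Fin T) (_ : s < t),
    MeasurableSpace.comap (fun ω => (a s ω, ℓ ω s (a s ω))) inferInstance

/-- The adversary's information at the beginning of round `t`: the whole loss sequence together
with everything the player has seen and done so far. -/
abbrev fullHistory (ℓ : Ω → LossSeq d T) (a : Fin T → Ω → Fin d) (t : Fin T) :
    MeasurableSpace Ω :=
  MeasurableSpace.comap ℓ inferInstance ⊔ history ℓ a t

/-- `p_t(i)`: the posterior probability that the optimal arm is `i`, given the player's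
information at the beginning of round `t`. -/
noncomputable def posteriorArm [MeasurableSpace Ω] (μ : Measure Ω) (best : LossSeq d T → Fin d)
    (ℓ : Ω → LossSeq d T) (a : Fin T → Ω → Fin d) (t : Fin T) (i : Fin d) : Ω → ℝ :=
  μ[fun ω => if best (ℓ ω) = i then (1 : ℝ) else 0 | history ℓ a t]

/-- On the probability space `(Ω, μ)`, the random losses `ℓ` and the random arms `a` are a
bandit game with prior `ν` played by Thompson Sampling: the losses have law `ν` and, in each
round `t`, conditionally on the whole loss sequence and on the past, the arm `a_t` is drawn
from the posterior distribution `p_t` of the optimal arm. -/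
structure IsThompsonSampling [MeasurableSpace Ω] (μ : Measure Ω) (ν : Measure (LossSeq d T))
    (best : LossSeq d T → Fin d) (ℓ : Ω → LossSeq d T) (a : Fin T → Ω → Fin d) : Prop where
  prob : IsProbabilityMeasure μ
  measurable_loss : Measurable ℓ
  measurable_arm : ∀ t, Measurable (a t)
  law_loss : μ.map ℓ = ν
  sample : ∀ t i,
    μ[fun ω => if a t ω = i then (1 : ℝ) else 0 | fullHistory ℓ a t]
      =ᵐ[μ] posteriorArm μ best ℓ a t i

/-- The expected regret `E[R_T] = E[∑_t ℓ_t(a_t) - L*]`. -/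
noncomputable def expectedRegret [MeasurableSpace Ω] (μ : Measure Ω)
    (ℓ : Ω → LossSeq d T) (a : Fin T → Ω → Fin d) : ℝ :=
  ∫ ω, ((∑ t, ℓ ω t (a t ω)) - bestLoss (ℓ ω)) ∂μ

end Game

end BanditTS

namespace BanditTS

/-! ### A maximal inequality for martingales, and the confidence bound for one arm. -/

section Confidence

variable {Ω : Type*} {m0 : MeasurableSpace Ω} {μ : Measure Ω}

/-! Because the played arm and the optimal arm have the same conditional law, the expected regret is
the sum over arms and rounds of `E[(p - 1_A) l]`, where `A` is the event that the arm is optimal and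
`p` is its posterior. Each arm is analysed separately (`ArmModel`), splitting rounds at a posterior
threshold `γ = 2 log T / L`.

Rare arms. `ArmModel.confidence` shows that an arm cannot be played at much loss while still looking
plausible. Let `N` be the weighted loss observed and `Q` its compensator. Since `1_A exp(N - 2Q)`
has mean at most one and `Q ≤ γL` on `A`, the martingale `E[1_A exp(N_T - 2γL) | F n]` has mean at
most one; it dominates `p exp(N - 2γL)`. The logarithm of its running maximum has bounded mean, so
`E[N] = E[Q]` is at most `2γL + log(1/ε) + O(1)` when only rounds with `p ≥ ε` count. With `ε = 1/T`
this gives `∑ E[min(p, γ) l] = O(log T)`: the loss at posterior at most `γ` is `O(log T)`, and the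
loss the arm incurs, played or not, while its posterior exceeds `γ` is `O(L)`.

Likely arms. Importance weighting rewrites the regret of a round as `E[(x l / p)(p - p')]`, with `x`
the play indicator and `p'` the next posterior. As `x l ≥ 0`, only decreases of the posterior
matter. AM-GM separates a local term `E[p^(1-α) l]` from `E[p^(α-2) (p - p')₊²]`; the latter is paid
for by the decrease of `∑ p^α`, which telescopes to the Tsallis entropy
(`ArmModel.integral_drop_le`, `ArmModel.integral_regret_le_drop`).

Summing over arms, the local terms are at most of order `d^α (R + L)` with `R` the regret itself;
`regret_tuning` solves this self-bounding inequality. Part (2) follows from `H_α(p_1) d^α ≤ 2d /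
(α(1-α))`. The `log²` term is needed only for `T = 1` in part (2), where `log T` vanishes. -/

lemma integrable_of_mem_Icc [IsFiniteMeasure μ] {f : Ω → ℝ} (hf : Measurable f) {c C : ℝ}
    (h : ∀ ω, f ω ∈ Set.Icc c C) : Integrable f μ :=
  Integrable.of_mem_Icc c C hf.aemeasurable (ae_of_all _ h)

/-- Integration against a bounded `m`-measurable weight does not distinguish a function from its
conditional expectation. -/
lemma integral_mul_eq_of_condExp {m : MeasurableSpace Ω} (hm : m ≤ m0) [IsProbabilityMeasure μ]
    {f h g : Ω → ℝ} (hf : Integrable f μ) (hh : μ[f | m] =ᵐ[μ] h)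
    (hg : Measurable[m] g) {C : ℝ} (hC : ∀ ω, |g ω| ≤ C) :
    ∫ ω, g ω * f ω ∂μ = ∫ ω, g ω * h ω ∂μ := by
  have h1 := condExp_stronglyMeasurable_mul_of_bound hm hg.stronglyMeasurable hf C
    (ae_of_all _ hC)
  calc ∫ ω, g ω * f ω ∂μ = ∫ ω, (μ[g * f | m]) ω ∂μ := (integral_condExp hm).symm
    _ = ∫ ω, g ω * h ω ∂μ := by
      refine integral_congr_ae ?_
      filter_upwards [h1, hh] with ω h1 h2
      rw [h1, Pi.mul_apply, h2]

/-- A bounded function has an everywhere bounded version of its conditional expectation. -/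
lemma exists_condExp_version {m : MeasurableSpace Ω} (hm : m ≤ m0) [IsProbabilityMeasure μ]
    {V : Ω → ℝ} (hV : Measurable[m0] V) {C : ℝ} (hVC : ∀ ω, V ω ∈ Set.Icc 0 C) :
    ∃ Y : Ω → ℝ, Measurable[m] Y ∧ (∀ ω, Y ω ∈ Set.Icc 0 C) ∧ μ[V | m] =ᵐ[μ] Y := by
  have hi : Integrable V μ := integrable_of_mem_Icc hV hVC
  have : Nonempty Ω := μ.nonempty_of_neZero
  have hC : 0 ≤ C := (hVC (Classical.arbitrary Ω)).1.trans (hVC _).2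
  refine ⟨fun ω => max 0 (min C ((μ[V | m]) ω)), ?_, fun ω => ⟨le_max_left _ _, ?_⟩, ?_⟩
  · exact measurable_const.max (measurable_const.min stronglyMeasurable_condExp.measurable)
  · exact max_le hC (min_le_left _ _)
  · have h0 : 0 ≤ᵐ[μ] μ[V | m] := condExp_nonneg (ae_of_all _ fun ω => (hVC ω).1)
    have h1 : μ[V | m] ≤ᵐ[μ] μ[(fun _ => C) | m] :=
      condExp_mono hi (integrable_const C) (ae_of_all _ fun ω => (hVC ω).2)
    rw [condExp_const hm] at h1
    filter_upwards [h0, h1] with ω h0 h1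
    rw [min_eq_right h1]
    exact (max_eq_right h0).symm

/-- The running maximum of `1, Y 0, …, Y (n - 1)`. -/
noncomputable def runMax (Y : ℕ → Ω → ℝ) : ℕ → Ω → ℝ
  | 0 => fun _ => 1
  | n + 1 => fun ω => max (runMax Y n ω) (Y n ω)

lemma one_le_runMax (Y : ℕ → Ω → ℝ) (n : ℕ) (ω : Ω) : 1 ≤ runMax Y n ω := by
  induction n with
  | zero => exact le_rfl
  | succ n ih => exact ih.trans (le_max_left _ _)

lemma runMax_le {Y : ℕ → Ω → ℝ} {C : ℝ} (hY : ∀ n ω, Y n ω ≤ C) (n : ℕ) (ω : Ω) :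
    runMax Y n ω ≤ max 1 C := by
  induction n with
  | zero => exact le_max_left _ _
  | succ n ih => exact max_le ih ((hY n ω).trans (le_max_right _ _))

lemma measurable_runMax_succ {F : Filtration ℕ m0} {Y : ℕ → Ω → ℝ}
    (hY : ∀ n, Measurable[F n] (Y n)) (n : ℕ) : Measurable[F n] (runMax Y (n + 1)) := by
  induction n with
  | zero => exact measurable_const.max (hY 0)
  | succ n ih => exact (ih.mono (F.mono n.le_succ) le_rfl).max (hY (n + 1))

lemma measurable_runMax {F : Filtration ℕ m0} {Y : ℕ → Ω → ℝ}
    (hY : ∀ n, Measurable[F n] (Y n)) (n : ℕ) : Measurable[F n] (runMax Y n) := by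
  cases n with
  | zero => exact measurable_const
  | succ n => exact (measurable_runMax_succ hY n).mono (F.mono n.le_succ) le_rfl

/-- When `y > s` this is `log u ≤ u - 1` at `u = y / s`. It makes `log S + Y / S` a potential that
does not grow when the running maximum `S` is updated. -/
lemma log_max_add_div_max_le {s y : ℝ} (hs : 1 ≤ s) :
    Real.log (max s y) + y / max s y ≤ Real.log s + y / s := by
  rcases le_total y s with h | h
  · rw [max_eq_left h]
  · rw [max_eq_right h, div_self (by linarith)]
    have h0 : 0 < s := by linarith
    have := Real.log_le_sub_one_of_pos (show 0 < y / s by apply div_pos <;> linarith)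
    rw [Real.log_div (by linarith) (by linarith)] at this
    linarith

/-- The logarithm of the maximum of a nonnegative martingale has expectation at most its mean. -/
lemma integral_log_runMax_le [IsProbabilityMeasure μ] (F : Filtration ℕ m0) {V : Ω → ℝ}
    {Y : ℕ → Ω → ℝ} {C : ℝ} (hV : Integrable V μ) (hY : ∀ n, Measurable[F n] (Y n))
    (hYC : ∀ n ω, Y n ω ∈ Set.Icc 0 C) (hVY : ∀ n, μ[V | F n] =ᵐ[μ] Y n) (n : ℕ) :
    ∫ ω, Real.log (runMax Y n ω) ∂μ ≤ ∫ ω, V ω ∂μ := by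
  have hS := one_le_runMax Y
  have hY' : ∀ n, Measurable (Y n) := fun n => (hY n).mono (F.le n) le_rfl
  have hS' : ∀ n, Measurable (runMax Y n) := fun n =>
    (measurable_runMax hY n).mono (F.le n) le_rfl
  have ilog : ∀ n, Integrable (fun ω => Real.log (runMax Y n ω)) μ := fun n =>
    integrable_of_mem_Icc (hS' n).log (c := 0) (C := Real.log (max 1 C)) fun ω =>
      ⟨Real.log_nonneg (hS n ω), Real.log_le_log (by linarith [hS n ω])
        (runMax_le (fun n ω => (hYC n ω).2) n ω)⟩
  have hq : ∀ n k ω, Y n ω / runMax Y k ω ∈ Set.Icc 0 C := fun n k ω =>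
    ⟨div_nonneg (hYC n ω).1 (by linarith [hS k ω]),
      (div_le_self (hYC n ω).1 (hS k ω)).trans (hYC n ω).2⟩
  have idiv : ∀ n k, Integrable (fun ω => Y n ω / runMax Y k ω) μ := fun n k =>
    integrable_of_mem_Icc ((hY' n).div (hS' k)) (hq n k)
  have hex : ∀ n k, Measurable[F n] (runMax Y k) →
      ∫ ω, Y n ω / runMax Y k ω ∂μ = ∫ ω, V ω / runMax Y k ω ∂μ := by
    intro n k hk
    have := integral_mul_eq_of_condExp (F.le n) hV (hVY n) (g := fun ω => (runMax Y k ω)⁻¹)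
      hk.inv (C := 1) (fun ω => by
        rw [abs_of_nonneg (inv_nonneg.2 (by linarith [hS k ω]))]
        exact inv_le_one_of_one_le₀ (hS k ω))
    simp only [div_eq_inv_mul]
    exact this.symm
  -- The potential `E[log S_n + Y_n / S_n]` never increases. The running maximum stops one index
  -- early, so `S_(n+1)` is `F n`-measurable and the martingale property exchanges `Y_(n+1) /
  -- S_(n+1)` for `Y_n / S_(n+1)`.
  have key : ∀ n, ∫ ω, (Real.log (runMax Y n ω) + Y n ω / runMax Y n ω) ∂μ ≤ ∫ ω, V ω ∂μ := by
    intro n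
    induction n with
    | zero =>
      rw [integral_add (ilog 0) (idiv 0 0), hex 0 0 (measurable_runMax hY 0)]
      simp [runMax]
    | succ n ih =>
      rw [integral_add (ilog _) (idiv _ _), hex (n + 1) (n + 1) (measurable_runMax hY _),
        ← hex n (n + 1) (measurable_runMax_succ hY n), ← integral_add (ilog _) (idiv _ _)]
      refine le_trans (integral_mono ((ilog _).add (idiv _ _)) ((ilog _).add (idiv _ _))
        fun ω => ?_) ih
      exact log_max_add_div_max_le (hS n ω)
  refine le_trans (integral_mono (ilog n) ((ilog n).add (idiv n n)) fun ω => ?_) (key n)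
  have := (hq n n ω).1
  simp only [Pi.add_apply]
  linarith

/-- One arm of a bandit game played by Thompson Sampling. `A` is the event that the arm is
optimal, `p n` its posterior probability given the player's information `F n`, `x n` the
indicator that the arm is played and `l n` its loss; `G n` also contains the losses. -/
structure ArmModel (μ : Measure Ω) (F G : Filtration ℕ m0) (T : ℕ) (A : Set Ω)
    (p x l : ℕ → Ω → ℝ) : Prop where
  le : ∀ n, F n ≤ G n
  meas_A : MeasurableSet[G 0] A
  meas_p : ∀ n, Measurable[F n] (p n)
  p_mem : ∀ n ω, p n ω ∈ Set.Icc (0 : ℝ) 1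
  p_eq : ∀ n, μ[A.indicator (fun _ => (1 : ℝ)) | F n] =ᵐ[μ] p n
  meas_l : ∀ n, Measurable[G n] (l n)
  l_mem : ∀ n ω, l n ω ∈ Set.Icc (0 : ℝ) 1
  meas_x : ∀ n, Measurable (x n)
  x_mem : ∀ n ω, x n ω ∈ Set.Icc (0 : ℝ) 1
  meas_xl : ∀ n, Measurable[F (n + 1)] (fun ω => x n ω * l n ω)
  sample : ∀ n < T, μ[x n | G n] =ᵐ[μ] p n

namespace ArmModel

variable {F G : Filtration ℕ m0} {T : ℕ} {A : Set Ω} {p x l : ℕ → Ω → ℝ}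

lemma ind_mem (A : Set Ω) (ω : Ω) : A.indicator (fun _ => (1 : ℝ)) ω ∈ Set.Icc (0 : ℝ) 1 := by
  by_cases h : ω ∈ A <;> simp [h]

lemma meas_ind (h : ArmModel μ F G T A p x l) (n : ℕ) :
    Measurable[G n] (A.indicator (fun _ => (1 : ℝ))) :=
  Measurable.indicator measurable_const (G.mono (Nat.zero_le n) _ h.meas_A)

lemma integral_mul_x (h : ArmModel μ F G T A p x l) [IsProbabilityMeasure μ] {n : ℕ}
    (hn : n < T) {g : Ω → ℝ} (hg : Measurable[G n] g) {C : ℝ} (hC : ∀ ω, |g ω| ≤ C) :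
    ∫ ω, g ω * x n ω ∂μ = ∫ ω, g ω * p n ω ∂μ :=
  integral_mul_eq_of_condExp (G.le n) (integrable_of_mem_Icc (h.meas_x n) (h.x_mem n))
    (h.sample n hn) hg hC

lemma integral_mul_ind (h : ArmModel μ F G T A p x l) [IsProbabilityMeasure μ] {n : ℕ}
    {g : Ω → ℝ} (hg : Measurable[F n] g) {C : ℝ} (hC : ∀ ω, |g ω| ≤ C) :
    ∫ ω, g ω * A.indicator (fun _ => (1 : ℝ)) ω ∂μ = ∫ ω, g ω * p n ω ∂μ :=
  integral_mul_eq_of_condExp (F.le n)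
    (integrable_of_mem_Icc ((h.meas_ind 0).mono (G.le 0) le_rfl) (ind_mem A))
    (h.p_eq n) hg hC

/-- If the arm is optimal with a total weighted loss of at most `γ * L`, then the weighted loss
suffered by playing it while its posterior probability is at least `ε` is of that order, up to
a term of order `log (1 / ε)`. -/
theorem confidence (h : ArmModel μ F G T A p x l) [IsProbabilityMeasure μ] {w : ℕ → Ω → ℝ}
    {γ L ε : ℝ} (hγ : 0 ≤ γ) (hL : 0 ≤ L) (hε : 0 < ε) (hε1 : ε ≤ 1)
    (hw : ∀ n, Measurable[F n] (w n)) (hw01 : ∀ n ω, w n ω ∈ Set.Icc (0 : ℝ) 1)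
    (hwε : ∀ n ω, w n ω ≠ 0 → ε ≤ p n ω) (hwγ : ∀ n ω, p n ω * w n ω ≤ γ)
    (hA : ∀ᵐ ω ∂μ, ω ∈ A → ∑ n ∈ Finset.range T, l n ω ≤ L) :
    ∫ ω, ∑ n ∈ Finset.range T, p n ω * l n ω * w n ω ∂μ ≤ 2 * γ * L + Real.log (1 / ε) + 2 := by
  set I : Ω → ℝ := A.indicator (fun _ => (1 : ℝ)) with hI
  set N : ℕ → Ω → ℝ := fun n ω => ∑ s ∈ Finset.range n, x s ω * l s ω * w s ω with hN
  set Q : ℕ → Ω → ℝ := fun n ω => ∑ s ∈ Finset.range n, p s ω * l s ω * w s ω with hQ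
  have hI01 : ∀ ω, I ω ∈ Set.Icc (0 : ℝ) 1 := ind_mem A
  have hxlw : ∀ n ω, x n ω * l n ω * w n ω ∈ Set.Icc (0 : ℝ) 1 := fun n ω =>
    unitInterval.mul_mem (unitInterval.mul_mem (h.x_mem n ω) (h.l_mem n ω)) (hw01 n ω)
  have hplw : ∀ n ω, p n ω * l n ω * w n ω ∈ Set.Icc (0 : ℝ) 1 := fun n ω =>
    unitInterval.mul_mem (unitInterval.mul_mem (h.p_mem n ω) (h.l_mem n ω)) (hw01 n ω)
  have hN0 : ∀ (n : ℕ) ω, N n ω ∈ Set.Icc (0 : ℝ) n := fun n ω =>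
    ⟨Finset.sum_nonneg fun s _ => (hxlw s ω).1,
      (Finset.sum_le_sum fun s _ => (hxlw s ω).2).trans (by simp)⟩
  have hQ0 : ∀ (n : ℕ) ω, Q n ω ∈ Set.Icc (0 : ℝ) n := fun n ω =>
    ⟨Finset.sum_nonneg fun s _ => (hplw s ω).1,
      (Finset.sum_le_sum fun s _ => (hplw s ω).2).trans (by simp)⟩
  have mN : ∀ n, Measurable[F n] (N n) := fun n =>
    Finset.measurable_fun_sum _ fun s hs =>
      ((h.meas_xl s).mono (F.mono (Finset.mem_range.1 hs)) le_rfl).mul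
        ((hw s).mono (F.mono (Finset.mem_range.1 hs).le) le_rfl)
  have mQ : ∀ n, Measurable[G n] (Q n) := fun n =>
    Finset.measurable_fun_sum _ fun s hs =>
      (((h.meas_p s).mono ((h.le s).trans (G.mono (Finset.mem_range.1 hs).le)) le_rfl).mul
        ((h.meas_l s).mono (G.mono (Finset.mem_range.1 hs).le) le_rfl)).mul
        ((hw s).mono ((h.le s).trans (G.mono (Finset.mem_range.1 hs).le)) le_rfl)
  have mN' : ∀ n, Measurable (N n) := fun n => (mN n).mono (F.le n) le_rfl
  have mQ' : ∀ n, Measurable (Q n) := fun n => (mQ n).mono (G.le n) le_rfl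
  have mI : Measurable I := (h.meas_ind 0).mono (G.le 0) le_rfl
  have mgf_mem : ∀ (n : ℕ) ω, I ω * Real.exp (N n ω - 2 * Q n ω) ∈ Set.Icc (0 : ℝ) (Real.exp n) := by
    intro n ω
    refine ⟨mul_nonneg (hI01 ω).1 (Real.exp_nonneg _), ?_⟩
    refine (mul_le_of_le_one_left (Real.exp_nonneg _) (hI01 ω).2).trans (Real.exp_le_exp.2 ?_)
    linarith [(hN0 n ω).2, (hQ0 n ω).1]
  -- The event `A` and the losses are `G n`-measurable, so even under the weight `1_A` the arm is
  -- still played with conditional probability `p n`, and the exponential supermartingale argument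
  -- survives.
  have mgf : ∀ n ≤ T, ∫ ω, I ω * Real.exp (N n ω - 2 * Q n ω) ∂μ ≤ 1 := by
    intro n
    induction n with
    | zero =>
      intro _
      have : ∫ ω, I ω ∂μ ≤ ∫ ω, (1 : ℝ) ∂μ :=
        integral_mono (integrable_of_mem_Icc mI hI01) (integrable_const _) fun ω => (hI01 ω).2
      simpa [N, Q] using this
    | succ n ih =>
      intro hn
      refine le_trans ?_ (ih (by omega))
      have mg : Measurable[G n] (fun ω => I ω * Real.exp (N n ω - 2 * Q n ω)
          * Real.exp (-(2 * (p n ω * l n ω * w n ω)))) := by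
        have m1 := (mN n).mono (h.le n) le_rfl
        have m2 := mQ n
        have m3 := h.meas_ind n
        have m4 := (h.meas_p n).mono (h.le n) le_rfl
        have m5 := (hw n).mono (h.le n) le_rfl
        have m6 := h.meas_l n
        exact (m3.mul (m1.sub (m2.const_mul 2)).exp).mul
          (((m4.mul m6).mul m5).const_mul 2).neg.exp
      set g : Ω → ℝ := fun ω => I ω * Real.exp (N n ω - 2 * Q n ω)
          * Real.exp (-(2 * (p n ω * l n ω * w n ω))) with hg
      have g_mem : ∀ ω, g ω ∈ Set.Icc (0 : ℝ) (Real.exp n) := fun ω =>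
        ⟨mul_nonneg (mgf_mem n ω).1 (Real.exp_nonneg _),
          (mul_le_of_le_one_right (mgf_mem n ω).1
            (Real.exp_le_one_iff.2 (by linarith [(hplw n ω).1]))).trans (mgf_mem n ω).2⟩
      have mg' : Measurable g := mg.mono (G.le n) le_rfl
      have mlw : Measurable[G n] (fun ω => g ω * (l n ω * w n ω)) :=
        mg.mul ((h.meas_l n).mul ((hw n).mono (h.le n) le_rfl))
      have lw_mem : ∀ ω, l n ω * w n ω ∈ Set.Icc (0 : ℝ) 1 := fun ω =>
        unitInterval.mul_mem (h.l_mem n ω) (hw01 n ω)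
      have glw_mem : ∀ ω, g ω * (l n ω * w n ω) ∈ Set.Icc (0 : ℝ) (Real.exp n) := fun ω =>
        ⟨mul_nonneg (g_mem ω).1 (lw_mem ω).1,
          (mul_le_of_le_one_right (g_mem ω).1 (lw_mem ω).2).trans (g_mem ω).2⟩
      have ig : Integrable g μ := integrable_of_mem_Icc mg' g_mem
      have mul_int : ∀ y : Ω → ℝ, Measurable y → (∀ ω, y ω ∈ Set.Icc (0 : ℝ) 1) →
          Integrable (fun ω => g ω * (l n ω * w n ω) * y ω) μ := fun y hy hy1 =>
        integrable_of_mem_Icc ((mlw.mono (G.le n) le_rfl).mul hy) (c := 0) (C := Real.exp n)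
          fun ω => ⟨mul_nonneg (glw_mem ω).1 (hy1 ω).1,
            (mul_le_of_le_one_right (glw_mem ω).1 (hy1 ω).2).trans (glw_mem ω).2⟩
      have ix := mul_int (x n) (h.meas_x n) (h.x_mem n)
      have ip := mul_int (p n) ((h.meas_p n).mono (F.le n) le_rfl) (h.p_mem n)
      have hex := h.integral_mul_x (n := n) (by omega) mlw (C := Real.exp n) fun ω => by
        rw [abs_of_nonneg (glw_mem ω).1]; exact (glw_mem ω).2
      calc ∫ ω, I ω * Real.exp (N (n + 1) ω - 2 * Q (n + 1) ω) ∂μ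
          ≤ ∫ ω, (g ω + 2 * (g ω * (l n ω * w n ω) * x n ω)) ∂μ := by
            refine integral_mono (integrable_of_mem_Icc ?_ (mgf_mem (n + 1)))
              (ig.add (ix.const_mul 2)) fun ω => ?_
            · exact mI.mul ((mN' _).sub ((mQ' _).const_mul 2)).exp
            · have e1 : Real.exp (N (n + 1) ω - 2 * Q (n + 1) ω)
                  = Real.exp (N n ω - 2 * Q n ω) * Real.exp (-(2 * (p n ω * l n ω * w n ω)))
                    * Real.exp (x n ω * l n ω * w n ω) := by
                rw [← Real.exp_add, ← Real.exp_add]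
                congr 1
                simp only [hN, hQ, Finset.sum_range_succ]
                ring
              -- From `exp u ≤ 1 + u + u²` on `[0, 1]`; this is the source of the factor 2 in front
              -- of `Q`.
              have e2 : Real.exp (x n ω * l n ω * w n ω) ≤ 1 + 2 * (x n ω * l n ω * w n ω) := by
                obtain ⟨u0, u1⟩ := hxlw n ω
                have := Real.abs_exp_sub_one_sub_id_le (x := x n ω * l n ω * w n ω)
                  (by rw [abs_of_nonneg u0]; exact u1)
                have := (abs_le.1 this).2
                nlinarith
              have e3 := mul_le_mul_of_nonneg_left e2 (g_mem ω).1
              simp only [e1]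
              calc _ = g ω * Real.exp (x n ω * l n ω * w n ω) := by rw [hg]; ring
                _ ≤ _ := e3
                _ = _ := by ring
        _ = ∫ ω, (g ω + 2 * (g ω * (l n ω * w n ω) * p n ω)) ∂μ := by
            rw [integral_add ig (ix.const_mul 2), integral_add ig (ip.const_mul 2),
              integral_const_mul, integral_const_mul, hex]
        _ ≤ ∫ ω, I ω * Real.exp (N n ω - 2 * Q n ω) ∂μ := by
            refine integral_mono (ig.add (ip.const_mul 2)) (integrable_of_mem_Icc
              (mI.mul ((mN' _).sub ((mQ' _).const_mul 2)).exp) (mgf_mem n)) fun ω => ?_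
            set u := p n ω * l n ω * w n ω with hu
            have e1 : (1 + 2 * u) * Real.exp (-(2 * u)) ≤ 1 := by
              have := Real.add_one_le_exp (2 * u)
              calc _ ≤ Real.exp (2 * u) * Real.exp (-(2 * u)) :=
                    mul_le_mul_of_nonneg_right (by linarith) (Real.exp_nonneg _)
                _ = 1 := by rw [← Real.exp_add]; simp
            have e2 := mul_le_mul_of_nonneg_left e1 (mgf_mem n ω).1
            calc _ = I ω * Real.exp (N n ω - 2 * Q n ω) * ((1 + 2 * u) * Real.exp (-(2 * u))) := by
                  rw [hg, hu]; ring
              _ ≤ _ := by simpa using e2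
  set V : Ω → ℝ := fun ω => I ω * Real.exp (N T ω - 2 * γ * L) with hV
  have hγL : 0 ≤ γ * L := mul_nonneg hγ hL
  have V_mem : ∀ ω, V ω ∈ Set.Icc (0 : ℝ) (Real.exp T) := fun ω => by
    refine ⟨mul_nonneg (hI01 ω).1 (Real.exp_nonneg _), ?_⟩
    refine (mul_le_of_le_one_left (Real.exp_nonneg _) (hI01 ω).2).trans (Real.exp_le_exp.2 ?_)
    linarith [(hN0 T ω).2]
  have mV : Measurable V := mI.mul ((mN' T).sub_const _).exp
  have iV : Integrable V μ := integrable_of_mem_Icc mV V_mem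
  have hV1 : ∫ ω, V ω ∂μ ≤ 1 := by
    refine le_trans (integral_mono_ae iV (integrable_of_mem_Icc
      (mI.mul ((mN' _).sub ((mQ' _).const_mul 2)).exp) (mgf_mem T)) ?_) (mgf T le_rfl)
    filter_upwards [hA] with ω hω
    by_cases hωA : ω ∈ A
    · refine mul_le_mul_of_nonneg_left (Real.exp_le_exp.2 ?_) (hI01 ω).1
      have : Q T ω ≤ γ * L := by
        calc Q T ω ≤ ∑ n ∈ Finset.range T, γ * l n ω := Finset.sum_le_sum fun s _ => by
              have := mul_le_mul_of_nonneg_right (hwγ s ω) (h.l_mem s ω).1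
              linarith
          _ = γ * ∑ n ∈ Finset.range T, l n ω := by rw [Finset.mul_sum]
          _ ≤ γ * L := mul_le_mul_of_nonneg_left (hω hωA) hγ
      change N T ω - 2 * Q T ω ≥ _
      linarith
    · simp [hV, hI, hωA]
  choose Y mY Y_mem hVY using fun n => exists_condExp_version (F.le n) (μ := μ) mV V_mem
  have hlog := (integral_log_runMax_le F iV mY Y_mem hVY T).trans hV1
  -- `N` is nondecreasing and `N n` is known at time `n`, so it leaves the conditional expectation
  -- and `1_A` becomes `p n`.
  have hYp : ∀ n ≤ T, ∀ᵐ ω ∂μ, p n ω * Real.exp (N n ω - 2 * γ * L) ≤ Y n ω := by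
    intro n hn
    have eb : ∀ ω, ‖Real.exp (N n ω - 2 * γ * L)‖ ≤ Real.exp n := fun ω => by
      rw [Real.norm_of_nonneg (Real.exp_nonneg _)]
      exact Real.exp_le_exp.2 (by linarith [(hN0 n ω).2])
    have me : Measurable[F n] (fun ω => Real.exp (N n ω - 2 * γ * L)) :=
      ((mN n).sub_const _).exp
    have iI : Integrable I μ := integrable_of_mem_Icc mI hI01
    have h1 := condExp_stronglyMeasurable_mul_of_bound (F.le n) (μ := μ)
      me.stronglyMeasurable iI _ (ae_of_all _ eb)
    have h2 : μ[(fun ω => Real.exp (N n ω - 2 * γ * L)) * I | F n] ≤ᵐ[μ] μ[V | F n] := by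
      refine condExp_mono (iI.bdd_mul (me.mono (F.le n) le_rfl).aestronglyMeasurable
        (ae_of_all _ eb)) iV (ae_of_all _ fun ω => ?_)
      rw [Pi.mul_apply, mul_comm]
      refine mul_le_mul_of_nonneg_left (Real.exp_le_exp.2 ?_) (hI01 ω).1
      have : N n ω ≤ N T ω := Finset.sum_le_sum_of_subset_of_nonneg
        (Finset.range_mono hn) fun s _ _ => (hxlw s ω).1
      linarith
    filter_upwards [h1, h2, hVY n, h.p_eq n] with ω h1 h2 h3 h4
    rw [h3, h1, Pi.mul_apply, h4] at h2
    linarith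
  have hbound : ∀ᵐ ω ∂μ, N T ω ≤ 1 + 2 * γ * L + Real.log (1 / ε) + Real.log (runMax Y T ω) := by
    have hall : ∀ᵐ ω ∂μ, ∀ n, n ≤ T → p n ω * Real.exp (N n ω - 2 * γ * L) ≤ Y n ω :=
      ae_all_iff.2 fun n => by
        by_cases hn : n ≤ T
        · filter_upwards [hYp n hn] with ω hω _ using hω
        · exact ae_of_all _ fun ω hn' => absurd hn' hn
    filter_upwards [hall] with ω hω
    have hεl : 0 ≤ Real.log (1 / ε) := Real.log_nonneg (by rw [le_div_iff₀ hε]; linarith)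
    -- `N` grows only in rounds of nonzero weight, where `p ≥ ε` turns the bound on `Y` into one on
    -- `N`. The summand 1 pays for the loss of the current round.
    have : ∀ n ≤ T, N n ω ≤ 1 + 2 * γ * L + Real.log (1 / ε) + Real.log (runMax Y n ω) := by
      intro n
      induction n with
      | zero =>
        intro _
        simp only [hN, Finset.range_zero, Finset.sum_empty, runMax, Real.log_one]
        linarith
      | succ n ih =>
        intro hn
        have hs : N (n + 1) ω = N n ω + x n ω * l n ω * w n ω := by
          simp only [hN, Finset.sum_range_succ]
        by_cases hw0 : w n ω = 0
        · rw [hs, hw0, mul_zero, add_zero]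
          refine (ih (by omega)).trans ?_
          have := Real.log_le_log (by linarith [one_le_runMax Y n ω])
            (show runMax Y n ω ≤ runMax Y (n + 1) ω from le_max_left _ _)
          linarith
        · have h1 : ε * Real.exp (N n ω - 2 * γ * L) ≤ runMax Y (n + 1) ω :=
            (mul_le_mul_of_nonneg_right (hwε n ω hw0) (Real.exp_nonneg _)).trans
              ((hω n (by omega)).trans (le_max_right _ _))
          have h2 := Real.log_le_log (mul_pos hε (Real.exp_pos _)) h1
          rw [Real.log_mul hε.ne' (Real.exp_pos _).ne', Real.log_exp] at h2
          rw [one_div, Real.log_inv]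
          linarith [(hxlw n ω).2]
    exact this T le_rfl
  -- The sampling rule makes `Q` the compensator of `N`.
  have hNQ : ∫ ω, Q T ω ∂μ = ∫ ω, N T ω ∂μ := by
    have iplw : ∀ n, Integrable (fun ω => p n ω * l n ω * w n ω) μ := fun n =>
      integrable_of_mem_Icc ((((h.meas_p n).mono (F.le n) le_rfl).mul
        ((h.meas_l n).mono (G.le n) le_rfl)).mul ((hw n).mono (F.le n) le_rfl)) (hplw n)
    have ixlw : ∀ n, Integrable (fun ω => x n ω * l n ω * w n ω) μ := fun n =>
      integrable_of_mem_Icc (((h.meas_x n).mul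
        ((h.meas_l n).mono (G.le n) le_rfl)).mul ((hw n).mono (F.le n) le_rfl)) (hxlw n)
    simp only [hQ, hN]
    rw [integral_finsetSum _ fun n _ => iplw n, integral_finsetSum _ fun n _ => ixlw n]
    refine Finset.sum_congr rfl fun n hn => ?_
    have := h.integral_mul_x (Finset.mem_range.1 hn)
      (g := fun ω => l n ω * w n ω)
      ((h.meas_l n).mul ((hw n).mono (h.le n) le_rfl)) (C := 1) fun ω => by
        have := unitInterval.mul_mem (h.l_mem n ω) (hw01 n ω)
        rw [abs_of_nonneg this.1]; exact this.2
    calc _ = ∫ ω, l n ω * w n ω * p n ω ∂μ := by congr 1; ext ω; ring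
      _ = _ := this.symm
      _ = _ := by congr 1; ext ω; ring
  have ilog : Integrable (fun ω => Real.log (runMax Y T ω)) μ :=
    integrable_of_mem_Icc ((measurable_runMax mY T).mono (F.le T) le_rfl).log (c := 0)
      (C := Real.log (max 1 (Real.exp T))) fun ω => ⟨Real.log_nonneg (one_le_runMax Y T ω),
        Real.log_le_log (by linarith [one_le_runMax Y T ω])
          (runMax_le (fun n ω => (Y_mem n ω).2) T ω)⟩
  change ∫ ω, Q T ω ∂μ ≤ _
  rw [hNQ]
  calc ∫ ω, N T ω ∂μ
      ≤ ∫ ω, (1 + 2 * γ * L + Real.log (1 / ε) + Real.log (runMax Y T ω)) ∂μ :=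
        integral_mono_ae (integrable_of_mem_Icc (mN' T) (hN0 T))
          ((integrable_const _).add ilog) hbound
    _ = 1 + 2 * γ * L + Real.log (1 / ε) + ∫ ω, Real.log (runMax Y T ω) ∂μ := by
        rw [integral_add (integrable_const _) ilog]; simp
    _ ≤ _ := by linarith

end ArmModel

end Confidence

/-! ### Quantitative concavity of the power function. -/

section Tsallis

/-- The difference of the two sides vanishes at `s = 0` and is monotone: Bernoulli gives
`(1-s)^(1-α) ≤ 1 - (1-α)s`, whence `(1-s)^(α-1) ≥ 1 + (1-α)s`, which is the sign of the derivative.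
-/
lemma one_sub_rpow_le {α s : ℝ} (h0 : 0 < α) (h1 : α < 1) (hs0 : 0 ≤ s) (hs1 : s ≤ 1) :
    (1 - s) ^ α ≤ 1 - α * s - α * (1 - α) / 2 * s ^ 2 := by
  set f : ℝ → ℝ := fun s => 1 - α * s - α * (1 - α) / 2 * s ^ 2 - (1 - s) ^ α with hf
  have hd : ∀ s ∈ Set.Ioo (0 : ℝ) 1,
      HasDerivAt f (-α - α * (1 - α) * s + α * (1 - s) ^ (α - 1)) s := by
    intro s hs
    have e1 : HasDerivAt (fun s : ℝ => (1 - s) ^ α) (-1 * α * (1 - s) ^ (α - 1)) s :=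
      ((hasDerivAt_id s).const_sub 1).rpow_const (Or.inl (by simp; linarith [hs.2]))
    have e2 : HasDerivAt (fun s : ℝ => 1 - α * s - α * (1 - α) / 2 * s ^ 2)
        (-(α * 1) - α * (1 - α) / 2 * (2 * s)) s := by
      refine (((hasDerivAt_id s).const_mul α).const_sub 1).sub ?_
      simpa using (hasDerivAt_pow 2 s).const_mul (α * (1 - α) / 2)
    exact (e2.sub e1).congr_deriv (by ring)
  have hc : ContinuousOn f (Set.Icc 0 1) := by
    refine Continuous.continuousOn ?_
    have : Continuous fun s : ℝ => (1 - s) ^ α :=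
      (continuous_const.sub continuous_id).rpow_const fun _ => Or.inr h0.le
    simp only [hf]
    fun_prop
  have hm : MonotoneOn f (Set.Icc 0 1) := by
    refine monotoneOn_of_deriv_nonneg (convex_Icc 0 1) hc ?_ ?_
    · rw [interior_Icc]
      exact fun s hs => (hd s hs).differentiableAt.differentiableWithinAt
    · rw [interior_Icc]
      intro s hs
      rw [(hd s hs).deriv]
      have hb := rpow_one_add_le_one_add_mul_self (s := -s) (by linarith [hs.2])
        (p := 1 - α) (by linarith) (by linarith)
      have hpos : 0 < 1 - s := by linarith [hs.2]
      have hy : 0 < (1 - s) ^ (1 - α) := Real.rpow_pos_of_pos hpos _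
      have hb' : (1 - s) ^ (1 - α) ≤ 1 - (1 - α) * s := by
        rw [sub_eq_add_neg 1 s]; linarith
      have hinv : (1 - s) ^ (α - 1) = ((1 - s) ^ (1 - α))⁻¹ := by
        rw [← Real.rpow_neg hpos.le]; congr 1; ring
      have : 1 + (1 - α) * s ≤ (1 - s) ^ (α - 1) := by
        rw [hinv, le_inv_comm₀ (by nlinarith [hs.1]) hy]
        refine hb'.trans ?_
        rw [le_inv_comm₀ (by linarith) (by nlinarith [hs.1]), ← one_div,
          le_div_iff₀ (by linarith)]
        nlinarith [sq_nonneg ((1 - α) * s)]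
      nlinarith
  have := hm (Set.left_mem_Icc.2 zero_le_one) ⟨hs0, hs1⟩ hs0
  simp only [hf] at this
  norm_num at this
  linarith

/-- The concavity of `x ↦ x ^ α`, with a quadratic gain below the base point. -/
lemma rpow_le_tangent_sub {α p q : ℝ} (h0 : 0 < α) (h1 : α < 1) (hp : 0 < p) (hq : 0 ≤ q) :
    q ^ α ≤ p ^ α + α * p ^ (α - 1) * (q - p)
      - α * (1 - α) * (p ^ (α - 2) * max 0 (p - q) ^ 2 / 2) := by
  have e1 : p ^ α = p * p ^ (α - 1) := by
    rw [← Real.rpow_one_add' hp.le (by linarith)]; congr 1; ring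
  have e2 : p ^ α = p ^ 2 * p ^ (α - 2) := by
    rw [← Real.rpow_natCast, ← Real.rpow_add hp]; congr 1; push_cast; ring
  have hpα : 0 < p ^ α := Real.rpow_pos_of_pos hp _
  -- By homogeneity only the ratio matters. Above the base point Bernoulli's inequality suffices;
  -- below it `one_sub_rpow_le` supplies the quadratic gain.
  set u := q / p with hu
  have hqu : q = p * u := by rw [hu]; field_simp
  have hu0 : 0 ≤ u := div_nonneg hq hp.le
  have hqα : q ^ α = p ^ α * u ^ α := by rw [hqu, Real.mul_rpow hp.le hu0]
  rcases le_total p q with h | h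
  · have hu1 : 1 ≤ u := by rw [hu, le_div_iff₀ hp]; linarith
    have := rpow_one_add_le_one_add_mul_self (s := u - 1) (by linarith) h0.le h1.le
    rw [add_sub_cancel] at this
    rw [max_eq_left (by linarith), hqα]
    calc p ^ α * u ^ α ≤ p ^ α * (1 + α * (u - 1)) := mul_le_mul_of_nonneg_left this hpα.le
      _ = p ^ α + α * p ^ α * (u - 1) := by ring
      _ = p ^ α + α * (p * p ^ (α - 1)) * (u - 1) := by rw [← e1]
      _ = _ := by rw [hqu]; ring
  · have hu1 : u ≤ 1 := by rw [hu, div_le_one hp]; exact h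
    have := one_sub_rpow_le h0 h1 (s := 1 - u) (by linarith) (by linarith)
    rw [sub_sub_cancel] at this
    rw [max_eq_right (by linarith), hqα]
    calc p ^ α * u ^ α
        ≤ p ^ α * (1 - α * (1 - u) - α * (1 - α) / 2 * (1 - u) ^ 2) :=
          mul_le_mul_of_nonneg_left this hpα.le
      _ = p ^ α + α * p ^ α * (u - 1) - α * (1 - α) / 2 * (p ^ α) * (1 - u) ^ 2 := by ring
      _ = p ^ α + α * (p * p ^ (α - 1)) * (u - 1)
          - α * (1 - α) / 2 * (p ^ 2 * p ^ (α - 2)) * (1 - u) ^ 2 := by rw [← e1, ← e2]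
      _ = _ := by rw [hqu]; ring

end Tsallis

/-! ### Regret of one round against the decrease of the potential. -/

namespace ArmModel

variable {Ω : Type*} {m0 : MeasurableSpace Ω} {μ : Measure Ω}
  {F G : Filtration ℕ m0} {T : ℕ} {A : Set Ω} {p x l : ℕ → Ω → ℝ}

/-- The decrease of the Tsallis potential guaranteed by a drop of the posterior probability, on
the event that this probability exceeds `γ`. -/
noncomputable def drop (p : ℕ → Ω → ℝ) (α γ : ℝ) (n : ℕ) (ω : Ω) : ℝ :=
  if γ < p n ω then p n ω ^ (α - 2) * max 0 (p n ω - p (n + 1) ω) ^ 2 / 2 else 0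

lemma meas_ite (h : ArmModel μ F G T A p x l) (γ : ℝ) (n : ℕ) {g : Ω → ℝ}
    (hg : Measurable[F n] g) : Measurable[F n] (fun ω => if γ < p n ω then g ω else 0) :=
  Measurable.ite (measurableSet_lt measurable_const (h.meas_p n)) hg measurable_const

lemma meas_ite_rpow (h : ArmModel μ F G T A p x l) (γ : ℝ) (n : ℕ) (r : ℝ) :
    Measurable[F n] (fun ω => if γ < p n ω then p n ω ^ r else 0) :=
  h.meas_ite γ n ((h.meas_p n).pow_const r)

lemma ite_rpow_mem {γ r : ℝ} (hγ : 0 < γ) (hr : r ≤ 0) (n : ℕ) (ω : Ω) :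
    (if γ < p n ω then p n ω ^ r else 0) ∈ Set.Icc (0 : ℝ) (γ ^ r) := by
  split_ifs with hp
  · exact ⟨Real.rpow_nonneg (by linarith) _, Real.rpow_le_rpow_of_nonpos hγ hp.le hr⟩
  · exact ⟨le_rfl, Real.rpow_nonneg hγ.le _⟩

lemma rpow_mem (h : ArmModel μ F G T A p x l) {α : ℝ} (h0 : 0 < α) (n : ℕ) (ω : Ω) :
    p n ω ^ α ∈ Set.Icc (0 : ℝ) 1 :=
  ⟨Real.rpow_nonneg (h.p_mem n ω).1 _, Real.rpow_le_one (h.p_mem n ω).1 (h.p_mem n ω).2 h0.le⟩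

lemma measurable_p (h : ArmModel μ F G T A p x l) (n : ℕ) : Measurable (p n) :=
  (h.meas_p n).mono (F.le n) le_rfl

lemma measurable_l (h : ArmModel μ F G T A p x l) (n : ℕ) : Measurable (l n) :=
  (h.meas_l n).mono (G.le n) le_rfl

lemma integrable_drop (h : ArmModel μ F G T A p x l) [IsProbabilityMeasure μ] {α γ : ℝ}
    (h1 : α < 1) (hγ : 0 < γ) (n : ℕ) : Integrable (drop p α γ n) μ := by
  have e : ∀ ω, drop p α γ n ω = (if γ < p n ω then p n ω ^ (α - 2) else 0)
      * max 0 (p n ω - p (n + 1) ω) ^ 2 / 2 := fun ω => by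
    unfold drop; split_ifs <;> simp
  refine integrable_of_mem_Icc ?_ (c := 0) (C := γ ^ (α - 2)) fun ω => ?_
  · have m1 := (h.meas_ite_rpow γ n (α - 2)).mono (F.le n) le_rfl
    have m2 := (measurable_const (a := (0 : ℝ))).max
      ((h.measurable_p n).sub (h.measurable_p (n + 1)))
    have : drop p α γ n = _ := funext e
    rw [this]
    exact (m1.mul (m2.pow_const 2)).div_const 2
  · rw [e]
    obtain ⟨a0, a1⟩ := ite_rpow_mem (p := p) hγ (show α - 2 ≤ 0 by linarith) n ω
    have b0 : 0 ≤ max 0 (p n ω - p (n + 1) ω) := le_max_left _ _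
    have b1 : max 0 (p n ω - p (n + 1) ω) ≤ 1 :=
      max_le zero_le_one (by linarith [(h.p_mem n ω).2, (h.p_mem (n + 1) ω).1])
    have c0 : 0 ≤ max 0 (p n ω - p (n + 1) ω) ^ 2 := sq_nonneg _
    have c1 : max 0 (p n ω - p (n + 1) ω) ^ 2 ≤ 1 := pow_le_one₀ b0 b1
    refine ⟨by positivity, ?_⟩
    have := (mul_le_of_le_one_right a0 c1).trans a1
    have := mul_nonneg a0 c0
    linarith

/-- The posterior is a martingale, so this is conditional Jensen for a concave power. It handles
rounds with posterior at most `γ`, where the slope `p^(α-1)` of the tangent is not bounded. -/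
lemma condExp_rpow_le (h : ArmModel μ F G T A p x l) [IsProbabilityMeasure μ] {α : ℝ}
    (h0 : 0 < α) (h1 : α < 1) (n : ℕ) :
    μ[fun ω => p (n + 1) ω ^ α | F n] ≤ᵐ[μ] fun ω => p n ω ^ α := by
  have hint : Integrable (p (n + 1)) μ :=
    integrable_of_mem_Icc (h.measurable_p _) (h.p_mem _)
  have hpow : Integrable (fun ω => p (n + 1) ω ^ α) μ :=
    integrable_of_mem_Icc ((h.measurable_p _).pow_const α) (h.rpow_mem h0 _)
  have hcv : ConvexOn ℝ (Set.Ici (0 : ℝ)) (fun y => -(y ^ α)) :=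
    (Real.concaveOn_rpow h0.le h1.le).neg
  have hct : Continuous fun y : ℝ => -(y ^ α) :=
    (continuous_id.rpow_const fun _ => Or.inr h0.le).neg
  have hJ := hcv.map_condExp_le (μ := μ) (F.le n) (f := p (n + 1))
    (hct.lowerSemicontinuous.lowerSemicontinuousOn _)
    (ae_of_all _ fun ω => (h.p_mem _ ω).1) isClosed_Ici hint hpow.neg
  have ht : μ[p (n + 1) | F n] =ᵐ[μ] p n :=
    (condExp_congr_ae (h.p_eq (n + 1)).symm).trans
      ((condExp_condExp_of_le (F.mono n.le_succ) (F.le _)).trans (h.p_eq n))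
  have hneg := condExp_neg (μ := μ) (fun ω => p (n + 1) ω ^ α) (F n)
  have hcomp : (fun y : ℝ => -(y ^ α)) ∘ p (n + 1) = -(fun ω => p (n + 1) ω ^ α) := rfl
  rw [hcomp] at hJ
  filter_upwards [hJ, ht, hneg] with ω a b c
  rw [c, Pi.neg_apply, Function.comp_apply, b] at a
  linarith

/-- The expected decrease of the Tsallis potential in one round. -/
theorem integral_drop_le (h : ArmModel μ F G T A p x l) [IsProbabilityMeasure μ] {α γ : ℝ}
    (h0 : 0 < α) (h1 : α < 1) (hγ : 0 < γ) (n : ℕ) :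
    α * (1 - α) * ∫ ω, drop p α γ n ω ∂μ
      ≤ ∫ ω, p n ω ^ α ∂μ - ∫ ω, p (n + 1) ω ^ α ∂μ := by
  set b : Ω → ℝ := fun ω => if γ < p n ω then 0 else 1 with hb
  have mb : Measurable[F n] b :=
    Measurable.ite (measurableSet_lt measurable_const (h.meas_p n)) measurable_const
      measurable_const
  have mb' : Measurable b := mb.mono (F.le n) le_rfl
  have b_mem : ∀ ω, b ω ∈ Set.Icc (0 : ℝ) 1 := fun ω => by
    simp only [hb]; split_ifs <;> simp
  set g : Ω → ℝ := fun ω => if γ < p n ω then p n ω ^ (α - 1) else 0 with hg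
  have mg : Measurable[F n] g := h.meas_ite_rpow γ n (α - 1)
  have g_mem : ∀ ω, g ω ∈ Set.Icc (0 : ℝ) (γ ^ (α - 1)) := ite_rpow_mem hγ (by linarith) n
  have g_abs : ∀ ω, |g ω| ≤ γ ^ (α - 1) := fun ω => by
    rw [abs_of_nonneg (g_mem ω).1]; exact (g_mem ω).2
  have ipow : ∀ k, Integrable (fun ω => p k ω ^ α) μ := fun k =>
    integrable_of_mem_Icc ((h.measurable_p k).pow_const α) (h.rpow_mem h0 k)
  have ibpow : ∀ k, Integrable (fun ω => b ω * p k ω ^ α) μ := fun k =>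
    integrable_of_mem_Icc (mb'.mul ((h.measurable_p k).pow_const α)) fun ω =>
      unitInterval.mul_mem (b_mem ω) (h.rpow_mem h0 k ω)
  have igp : ∀ k, Integrable (fun ω => g ω * p k ω) μ := fun k =>
    (integrable_of_mem_Icc (h.measurable_p k) (h.p_mem k)).bdd_mul (c := γ ^ (α - 1))
      (mg.mono (F.le n) le_rfl).aestronglyMeasurable (ae_of_all _ g_abs)
  -- The linear term of the tangent inequality has mean zero.
  have hmart : ∫ ω, g ω * p (n + 1) ω ∂μ = ∫ ω, g ω * p n ω ∂μ := by
    rw [← h.integral_mul_ind mg g_abs,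
      ← h.integral_mul_ind (mg.mono (F.mono n.le_succ) le_rfl) g_abs]
  have hJ : ∫ ω, b ω * p (n + 1) ω ^ α ∂μ ≤ ∫ ω, b ω * p n ω ^ α ∂μ := by
    rw [integral_mul_eq_of_condExp (F.le n) (ipow (n + 1)) ae_eq_rfl mb (C := 1) fun ω => by
      rw [abs_of_nonneg (b_mem ω).1]; exact (b_mem ω).2]
    refine integral_mono_ae (integrable_condExp.bdd_mul (c := 1) mb'.aestronglyMeasurable
      (ae_of_all _ fun ω => ?_)) (ibpow n) ?_
    · rw [Real.norm_of_nonneg (b_mem ω).1]; exact (b_mem ω).2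
    · filter_upwards [h.condExp_rpow_le h0 h1 n] with ω hω
      exact mul_le_mul_of_nonneg_left hω (b_mem ω).1
  have idrop := h.integrable_drop (γ := γ) h1 hγ n
  -- Above the threshold this is the tangent inequality; below it, an identity in which `b = 1`
  -- leaves the comparison to `hJ`.
  have hpt : ∀ ω, p (n + 1) ω ^ α + α * (1 - α) * drop p α γ n ω + b ω * p n ω ^ α
      + α * (g ω * p n ω) ≤ b ω * p (n + 1) ω ^ α + p n ω ^ α + α * (g ω * p (n + 1) ω) := by
    intro ω
    simp only [hb, hg, drop]
    split_ifs with hp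
    · have := rpow_le_tangent_sub h0 h1 (hγ.trans hp) (h.p_mem (n + 1) ω).1
      linarith
    · simp only [mul_zero, zero_mul, one_mul]
      linarith
  have i1 : Integrable (fun ω => p (n + 1) ω ^ α + α * (1 - α) * drop p α γ n ω) μ :=
    (ipow (n + 1)).add (idrop.const_mul _)
  have i2 : Integrable (fun ω => p (n + 1) ω ^ α + α * (1 - α) * drop p α γ n ω
      + b ω * p n ω ^ α) μ := i1.add (ibpow n)
  have i3 : Integrable (fun ω => b ω * p (n + 1) ω ^ α + p n ω ^ α) μ :=
    (ibpow (n + 1)).add (ipow n)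
  have hI := integral_mono (i2.add ((igp n).const_mul α)) (i3.add ((igp (n + 1)).const_mul α)) hpt
  simp only [Pi.add_apply] at hI
  rw [integral_add i2 ((igp n).const_mul α), integral_add i1 (ibpow n),
    integral_add (ipow (n + 1)) (idrop.const_mul _), integral_add i3 ((igp (n + 1)).const_mul α),
    integral_add (ibpow (n + 1)) (ipow n), integral_const_mul, integral_const_mul,
    integral_const_mul, hmart] at hI
  linarith

/-- The regret of one round on the event that the posterior probability exceeds `γ`, in terms
of the decrease of the potential. -/
theorem integral_regret_le_drop (h : ArmModel μ F G T A p x l) [IsProbabilityMeasure μ]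
    {α γ lam : ℝ} (h0 : 0 < α) (h1 : α < 1) (hγ : 0 < γ) (hlam : 0 < lam) {n : ℕ} (hn : n < T) :
    ∫ ω, (if γ < p n ω then 1 else 0) *
        ((p n ω - A.indicator (fun _ => (1 : ℝ)) ω) * l n ω) ∂μ
      ≤ lam / 2 * ∫ ω, (if γ < p n ω then p n ω ^ (1 - α) else 0) * l n ω ∂μ
        + 1 / lam * ∫ ω, drop p α γ n ω ∂μ := by
  set I : Ω → ℝ := A.indicator (fun _ => (1 : ℝ)) with hI
  have I_mem : ∀ ω, I ω ∈ Set.Icc (0 : ℝ) 1 := ind_mem A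
  set g : Ω → ℝ := fun ω => if γ < p n ω then p n ω ^ (-1 : ℝ) else 0 with hg
  set e : Ω → ℝ := fun ω => if γ < p n ω then p n ω ^ (-α) else 0 with he
  have mg : Measurable[F n] g := h.meas_ite_rpow γ n (-1)
  have me : Measurable[F n] e := h.meas_ite_rpow γ n (-α)
  have g_mem : ∀ ω, g ω ∈ Set.Icc (0 : ℝ) (γ ^ (-1 : ℝ)) := ite_rpow_mem hγ (by norm_num) n
  have e_mem : ∀ ω, e ω ∈ Set.Icc (0 : ℝ) (γ ^ (-α)) := ite_rpow_mem hγ (by linarith) n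
  have mIG : Measurable[G n] I := h.meas_ind n
  have mI : Measurable I := mIG.mono (G.le n) le_rfl
  have xl_mem : ∀ ω, x n ω * l n ω ∈ Set.Icc (0 : ℝ) 1 := fun ω =>
    unitInterval.mul_mem (h.x_mem n ω) (h.l_mem n ω)
  have hgp : ∀ ω, g ω * p n ω = if γ < p n ω then 1 else 0 := fun ω => by
    simp only [hg]
    split_ifs with hp
    · rw [Real.rpow_neg_one, inv_mul_cancel₀ (by linarith)]
    · simp
  have hep : ∀ ω, e ω * p n ω = if γ < p n ω then p n ω ^ (1 - α) else 0 := fun ω => by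
    simp only [he]
    split_ifs with hp
    · rw [← Real.rpow_add_one (by linarith)]; congr 1; ring
    · simp
  -- Importance weighting: given `G n`, `x n / p n` has mean one where `p n > γ`.
  have step1 : ∫ ω, (if γ < p n ω then 1 else 0) * ((p n ω - I ω) * l n ω) ∂μ
      = ∫ ω, g ω * ((p n ω - I ω) * l n ω) * x n ω ∂μ := by
    rw [h.integral_mul_x hn (C := γ ^ (-1 : ℝ))]
    · congr 1; ext ω; rw [← hgp]; ring
    · exact (mg.mono (h.le n) le_rfl).mul
        ((((h.meas_p n).mono (h.le n) le_rfl).sub mIG).mul (h.meas_l n))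
    · intro ω
      rw [abs_mul, abs_of_nonneg (g_mem ω).1]
      refine (mul_le_of_le_one_right (g_mem ω).1 ?_).trans (g_mem ω).2
      rw [abs_mul, abs_of_nonneg (h.l_mem n ω).1]
      refine mul_le_one₀ ?_ (h.l_mem n ω).1 (h.l_mem n ω).2
      rw [abs_le]
      constructor <;> linarith [(h.p_mem n ω).1, (h.p_mem n ω).2, (I_mem ω).1, (I_mem ω).2]
  have mgxl : Measurable[F (n + 1)] (fun ω => g ω * (x n ω * l n ω)) :=
    (mg.mono (F.mono n.le_succ) le_rfl).mul (h.meas_xl n)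
  have gxl_mem : ∀ ω, g ω * (x n ω * l n ω) ∈ Set.Icc (0 : ℝ) (γ ^ (-1 : ℝ)) := fun ω =>
    ⟨mul_nonneg (g_mem ω).1 (xl_mem ω).1,
      (mul_le_of_le_one_right (g_mem ω).1 (xl_mem ω).2).trans (g_mem ω).2⟩
  have gxl_int : ∀ y : Ω → ℝ, Measurable y → (∀ ω, y ω ∈ Set.Icc (0 : ℝ) 1) →
      Integrable (fun ω => g ω * (x n ω * l n ω) * y ω) μ := fun y hy hy1 =>
    integrable_of_mem_Icc ((mgxl.mono (F.le _) le_rfl).mul hy) (c := 0) (C := γ ^ (-1 : ℝ))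
      fun ω => ⟨mul_nonneg (gxl_mem ω).1 (hy1 ω).1,
        (mul_le_of_le_one_right (gxl_mem ω).1 (hy1 ω).2).trans (gxl_mem ω).2⟩
  -- The observed loss `x l` is known at time `n + 1`, so `1_A` may be replaced by the next
  -- posterior.
  have step2 : ∫ ω, g ω * ((p n ω - I ω) * l n ω) * x n ω ∂μ
      = ∫ ω, (g ω * (x n ω * l n ω) * p n ω - g ω * (x n ω * l n ω) * p (n + 1) ω) ∂μ := by
    rw [integral_sub (gxl_int _ (h.measurable_p n) (h.p_mem n))
      (gxl_int _ (h.measurable_p _) (h.p_mem _)),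
      ← h.integral_mul_ind mgxl (C := γ ^ (-1 : ℝ)) fun ω => by
        rw [abs_of_nonneg (gxl_mem ω).1]; exact (gxl_mem ω).2,
      ← integral_sub (gxl_int _ (h.measurable_p n) (h.p_mem n)) (gxl_int _ mI I_mem)]
    congr 1; ext ω; ring
  have el_mem : ∀ ω, e ω * l n ω ∈ Set.Icc (0 : ℝ) (γ ^ (-α)) := fun ω =>
    ⟨mul_nonneg (e_mem ω).1 (h.l_mem n ω).1,
      (mul_le_of_le_one_right (e_mem ω).1 (h.l_mem n ω).2).trans (e_mem ω).2⟩
  have mel : Measurable[G n] (fun ω => e ω * l n ω) :=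
    (me.mono (h.le n) le_rfl).mul (h.meas_l n)
  have ielx : Integrable (fun ω => e ω * l n ω * x n ω) μ :=
    integrable_of_mem_Icc ((mel.mono (G.le n) le_rfl).mul (h.meas_x n)) (c := 0)
      (C := γ ^ (-α)) fun ω => ⟨mul_nonneg (el_mem ω).1 (h.x_mem n ω).1,
        (mul_le_of_le_one_right (el_mem ω).1 (h.x_mem n ω).2).trans (el_mem ω).2⟩
  have step3 : ∫ ω, (if γ < p n ω then p n ω ^ (1 - α) else 0) * l n ω ∂μ
      = ∫ ω, e ω * l n ω * x n ω ∂μ := by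
    rw [h.integral_mul_x hn mel (C := γ ^ (-α)) fun ω => by
      rw [abs_of_nonneg (el_mem ω).1]; exact (el_mem ω).2]
    congr 1; ext ω; rw [← hep]; ring
  have idrop := h.integrable_drop (γ := γ) h1 hγ n
  rw [step1, step2, step3, ← integral_const_mul, ← integral_const_mul,
    ← integral_add (ielx.const_mul _) (idrop.const_mul _)]
  refine integral_mono ((gxl_int _ (h.measurable_p n) (h.p_mem n)).sub
      (gxl_int _ (h.measurable_p _) (h.p_mem _)))
    ((ielx.const_mul _).add (idrop.const_mul _)) fun ω => ?_
  simp only [hg, he, drop]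
  split_ifs with hp
  swap
  · simp
  have hp0 : 0 < p n ω := hγ.trans hp
  obtain ⟨y0, y1⟩ := xl_mem ω
  set y := x n ω * l n ω with hy
  set D := max 0 (p n ω - p (n + 1) ω) with hD
  have hD0 : 0 ≤ D := le_max_left _ _
  have hD1 : p n ω - p (n + 1) ω ≤ D := le_max_right _ _
  -- Splitting `p⁻¹ = p^(-α/2) · p^(α/2-1)` makes the two squares in AM-GM the local term and the
  -- potential drop.
  set c := p n ω ^ (-α / 2) with hc
  set c' := p n ω ^ (α / 2 - 1) with hc'
  have e1 : p n ω ^ (-1 : ℝ) = c * c' := by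
    rw [hc, hc', ← Real.rpow_add hp0]; congr 1; ring
  have e2 : p n ω ^ (-α) = c ^ 2 := by
    rw [hc, ← Real.rpow_natCast, ← Real.rpow_mul hp0.le]; congr 1; push_cast; ring
  have e3 : p n ω ^ (α - 2) = c' ^ 2 := by
    rw [hc', ← Real.rpow_natCast, ← Real.rpow_mul hp0.le]; congr 1; push_cast; ring
  have hc0 : 0 ≤ c := Real.rpow_nonneg hp0.le _
  have hc0' : 0 ≤ c' := Real.rpow_nonneg hp0.le _
  rw [e1, e2, e3]
  -- Nonnegativity of the loss allows upward moves of the posterior to be discarded.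
  have a1 : c * c' * y * p n ω - c * c' * y * p (n + 1) ω ≤ c * c' * y * D := by
    rw [← mul_sub]
    exact mul_le_mul_of_nonneg_left hD1 (by positivity)
  have a2 : (c * y) * (c' * D) ≤ lam / 2 * (c * y) ^ 2 + 1 / lam * ((c' * D) ^ 2 / 2) := by
    have : 0 ≤ (lam * (c * y) - c' * D) ^ 2 / (2 * lam) := by positivity
    have e : (lam * (c * y) - c' * D) ^ 2 / (2 * lam)
      = lam / 2 * (c * y) ^ 2 + 1 / lam * ((c' * D) ^ 2 / 2) - (c * y) * (c' * D) := by
      field_simp; ring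
    linarith
  have a3 : lam / 2 * (c * y) ^ 2 ≤ lam / 2 * (c ^ 2 * y) := by
    refine mul_le_mul_of_nonneg_left ?_ (by positivity)
    rw [mul_pow]
    refine mul_le_mul_of_nonneg_left ?_ (sq_nonneg _)
    nlinarith
  calc _ ≤ (c * y) * (c' * D) := by linarith
    _ ≤ lam / 2 * (c ^ 2 * y) + 1 / lam * ((c' * D) ^ 2 / 2) := by linarith
    _ = _ := by rw [hy]; ring

end ArmModel

/-! ### Regret of one arm over all rounds. -/

lemma two_le_three_mul_log {T : ℕ} (hT : 2 ≤ T) : 2 ≤ 3 * Real.log T := by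
  have h1 : Real.log 2 ≤ Real.log T :=
    Real.log_le_log (by norm_num) (by exact_mod_cast hT)
  linarith [Real.log_two_gt_d9]

/-- Weighted AM-GM applied to `D p` and 1, divided by `D^(1-α)`. With `D = d`, the term free of `p`
contributes only `d^α` once summed over arms. -/
lemma rpow_one_sub_le {α p D : ℝ} (h0 : 0 < α) (h1 : α < 1) (hp : 0 ≤ p) (hD : 1 ≤ D) :
    p ^ (1 - α) ≤ D ^ α * p + D ^ (α - 1) := by
  have hD0 : 0 < D := by linarith
  have h := Real.geom_mean_le_arith_mean2_weighted (w₁ := 1 - α) (w₂ := α) (p₁ := D * p)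
    (p₂ := 1) (by linarith) h0.le (by positivity) zero_le_one (by ring)
  rw [Real.one_rpow, mul_one, mul_one, Real.mul_rpow hD0.le hp] at h
  have e1 : D ^ (α - 1) * D ^ (1 - α) = 1 := by
    rw [← Real.rpow_add hD0]; simp
  have e2 : D ^ α = D ^ (α - 1) * D := by
    rw [← Real.rpow_add_one hD0.ne']; congr 1; ring
  have hd : 0 < D ^ (α - 1) := Real.rpow_pos_of_pos hD0 _
  have h3 : D ^ (1 - α) * p ^ (1 - α) ≤ D * p + 1 := by
    have : 0 ≤ D * p := by positivity
    nlinarith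
  calc p ^ (1 - α) = D ^ (α - 1) * (D ^ (1 - α) * p ^ (1 - α)) := by
        rw [← mul_assoc, e1, one_mul]
    _ ≤ D ^ (α - 1) * (D * p + 1) := mul_le_mul_of_nonneg_left h3 hd.le
    _ = _ := by rw [e2]; ring

namespace ArmModel

variable {Ω : Type*} {m0 : MeasurableSpace Ω} {μ : Measure Ω}
  {F G : Filtration ℕ m0} {T : ℕ} {A : Set Ω} {p x l : ℕ → Ω → ℝ}

lemma ite_mul_mem (h : ArmModel μ F G T A p x l) (γ : ℝ) (n : ℕ) (ω : Ω) :
    (if γ < p n ω then 1 else 0) * l n ω ∈ Set.Icc (0 : ℝ) 1 := by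
  split_ifs
  · simpa using h.l_mem n ω
  · simp

lemma measurable_ite_const (h : ArmModel μ F G T A p x l) (γ u v : ℝ) (n : ℕ) :
    Measurable (fun ω => if γ < p n ω then u else v) :=
  Measurable.ite (measurableSet_lt measurable_const (h.measurable_p n)) measurable_const
    measurable_const

/-- The loss suffered by an arm with posterior probability at most `γ` and `γ` times the loss it
incurs while its posterior probability exceeds `γ` are logarithmic when `γ = 2 * log T / L`. -/
theorem sum_integral_threshold_le (h : ArmModel μ F G T A p x l) [IsProbabilityMeasure μ]
    {L γ : ℝ} (hL : 1 ≤ L) (hLT : L ≤ T) (hT : 2 ≤ T) (hγ : γ = 2 * Real.log T / L)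
    (hA : ∀ᵐ ω ∂μ, ω ∈ A → ∑ n ∈ Finset.range T, l n ω ≤ L) :
    ∑ n ∈ Finset.range T, ∫ ω, (if γ < p n ω then γ else p n ω) * l n ω ∂μ
      ≤ 10 * Real.log T := by
  have hlog := two_le_three_mul_log hT
  have hT0 : (0 : ℝ) < T := by linarith
  have hL0 : 0 < L := by linarith
  have hγ0 : 0 < γ := by rw [hγ]; exact div_pos (by linarith) hL0
  -- The cutoff `ε = 1/T` lies below the threshold, as `L ≤ T` and `2 log T ≥ 1`.
  have hγT : 1 / (T : ℝ) ≤ γ := by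
    rw [hγ, div_le_div_iff₀ hT0 hL0]
    nlinarith
  -- Chosen so that `p w = min p γ`, apart from posteriors below `1/T`, whose total contribution
  -- over `T` rounds is at most 1.
  set w : ℕ → Ω → ℝ := fun n ω => if 1 / (T : ℝ) ≤ p n ω then min 1 (γ / p n ω) else 0 with hw
  have w_mem : ∀ n ω, w n ω ∈ Set.Icc (0 : ℝ) 1 := fun n ω => by
    simp only [hw]
    split_ifs
    · exact ⟨le_min zero_le_one (div_nonneg hγ0.le (h.p_mem n ω).1), min_le_left _ _⟩
    · simp
  have mw : ∀ n, Measurable[F n] (w n) := fun n =>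
    Measurable.ite (measurableSet_le measurable_const (h.meas_p n))
      (measurable_const.min (measurable_const.div (h.meas_p n))) measurable_const
  have hc := h.confidence (w := w) (γ := γ) (L := L) (ε := 1 / (T : ℝ)) hγ0.le hL0.le
    (by positivity) (by rw [div_le_one hT0]; linarith) mw w_mem
    (fun n ω hne => by
      by_contra hlt
      exact hne (by simp only [hw]; rw [if_neg hlt]))
    (fun n ω => by
      simp only [hw]
      split_ifs with hp
      · have hp0 : 0 < p n ω := lt_of_lt_of_le (by positivity) hp
        calc _ ≤ p n ω * (γ / p n ω) := mul_le_mul_of_nonneg_left (min_le_right _ _) hp0.le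
          _ = γ := by field_simp
      · simpa using hγ0.le) hA
  have plw_mem : ∀ n ω, p n ω * l n ω * w n ω ∈ Set.Icc (0 : ℝ) 1 := fun n ω =>
    unitInterval.mul_mem (unitInterval.mul_mem (h.p_mem n ω) (h.l_mem n ω)) (w_mem n ω)
  have iplw : ∀ n, Integrable (fun ω => p n ω * l n ω * w n ω) μ := fun n =>
    integrable_of_mem_Icc (((h.measurable_p n).mul (h.measurable_l n)).mul
      ((mw n).mono (F.le n) le_rfl)) (plw_mem n)
  have hpt : ∀ n ω, (if γ < p n ω then γ else p n ω) * l n ω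
      ≤ p n ω * l n ω * w n ω + 1 / T := by
    intro n ω
    have hT' : 0 ≤ 1 / (T : ℝ) := by positivity
    obtain ⟨p0, p1⟩ := h.p_mem n ω
    obtain ⟨l0, l1⟩ := h.l_mem n ω
    simp only [hw]
    by_cases h2 : 1 / (T : ℝ) ≤ p n ω
    · have hp0 : 0 < p n ω := lt_of_lt_of_le (by positivity) h2
      rw [if_pos h2]
      split_ifs with h1
      · rw [min_eq_right (by rw [div_le_one hp0]; exact h1.le)]
        have : p n ω * l n ω * (γ / p n ω) = γ * l n ω := by field_simp
        linarith
      · rw [min_eq_left (by rw [le_div_iff₀ hp0]; linarith)]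
        linarith
    · rw [if_neg h2, if_neg (by linarith)]
      nlinarith
  have imin : ∀ n, Integrable (fun ω => (if γ < p n ω then γ else p n ω) * l n ω) μ := fun n => by
    refine integrable_of_mem_Icc ((Measurable.ite (measurableSet_lt measurable_const
      (h.measurable_p n)) measurable_const (h.measurable_p n)).mul (h.measurable_l n))
      (c := 0) (C := 1) fun ω => ?_
    obtain ⟨p0, p1⟩ := h.p_mem n ω
    refine unitInterval.mul_mem ?_ (h.l_mem n ω)
    split_ifs with h1
    · exact ⟨hγ0.le, by linarith⟩
    · exact ⟨p0, p1⟩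
  rw [integral_finsetSum _ fun n _ => iplw n] at hc
  calc ∑ n ∈ Finset.range T, ∫ ω, (if γ < p n ω then γ else p n ω) * l n ω ∂μ
      ≤ ∑ n ∈ Finset.range T, (∫ ω, p n ω * l n ω * w n ω ∂μ + 1 / T) := by
        refine Finset.sum_le_sum fun n _ => ?_
        refine (integral_mono (imin n) ((iplw n).add (integrable_const (1 / (T : ℝ))))
          (hpt n)).trans ?_
        simp only [Pi.add_apply]
        rw [integral_add (iplw n) (integrable_const _)]
        simp
    _ = ∑ n ∈ Finset.range T, ∫ ω, p n ω * l n ω * w n ω ∂μ + 1 := by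
        rw [Finset.sum_add_distrib]
        simp [hT0.ne']
    _ ≤ 2 * γ * L + Real.log (1 / (1 / (T : ℝ))) + 2 + 1 := by linarith
    -- `2γL = 4 log T`, the cutoff costs `log T`, and the remaining 3 is at most `4.5 log T`.
    _ ≤ 10 * Real.log T := by
        have : γ * L = 2 * Real.log T := by rw [hγ]; field_simp
        rw [one_div_one_div]
        nlinarith

/-- The regret incurred by playing one arm. -/
theorem sum_integral_regret_le (h : ArmModel μ F G T A p x l) [IsProbabilityMeasure μ]
    {α lam D L : ℝ} (h0 : 0 < α) (h1 : α < 1) (hlam : 0 < lam) (hD : 1 ≤ D) (hL : 1 ≤ L)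
    (hLT : L ≤ T) (hT : 2 ≤ T)
    (hA : ∀ᵐ ω ∂μ, ω ∈ A → ∑ n ∈ Finset.range T, l n ω ≤ L) :
    ∑ n ∈ Finset.range T, ∫ ω, (p n ω - A.indicator (fun _ => (1 : ℝ)) ω) * l n ω ∂μ
      ≤ lam / 2 * (D ^ α * (∑ n ∈ Finset.range T, ∫ ω, p n ω * l n ω ∂μ)
          + D ^ (α - 1) * (5 * L))
        + 1 / lam * ((∫ ω, p 0 ω ^ α ∂μ - ∫ ω, p T ω ^ α ∂μ) / (α * (1 - α)))
        + 10 * Real.log T := by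
  have hlog := two_le_three_mul_log hT
  have hL0 : 0 < L := by linarith
  obtain ⟨γ, hγ⟩ : ∃ γ, γ = 2 * Real.log T / L := ⟨_, rfl⟩
  have hγ0 : 0 < γ := by rw [hγ]; exact div_pos (by linarith) hL0
  have hthr := h.sum_integral_threshold_le hL hLT hT hγ hA
  set I : Ω → ℝ := A.indicator (fun _ => (1 : ℝ)) with hI
  have I_mem : ∀ ω, I ω ∈ Set.Icc (0 : ℝ) 1 := ind_mem A
  have mI : Measurable I := (h.meas_ind 0).mono (G.le 0) le_rfl
  have mp := h.measurable_p
  have ml := h.measurable_l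
  have ipl : ∀ n, Integrable (fun ω => p n ω * l n ω) μ := fun n =>
    integrable_of_mem_Icc ((mp n).mul (ml n)) fun ω =>
      unitInterval.mul_mem (h.p_mem n ω) (h.l_mem n ω)
  have ilow : ∀ n, Integrable (fun ω => (if γ < p n ω then 0 else 1) * (p n ω * l n ω)) μ :=
    fun n => integrable_of_mem_Icc ((h.measurable_ite_const γ 0 1 n).mul ((mp n).mul (ml n)))
      (c := 0) (C := 1) fun ω => unitInterval.mul_mem (by split_ifs <;> simp)
        (unitInterval.mul_mem (h.p_mem n ω) (h.l_mem n ω))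
  have ibl : ∀ n, Integrable (fun ω => (if γ < p n ω then 1 else 0) * l n ω) μ :=
    fun n => integrable_of_mem_Icc ((h.measurable_ite_const γ 1 0 n).mul (ml n))
      (h.ite_mul_mem γ n)
  have ireg : ∀ n, Integrable (fun ω => (p n ω - I ω) * l n ω) μ := fun n =>
    integrable_of_mem_Icc (((mp n).sub mI).mul (ml n)) (c := -1) (C := 1) fun ω => by
      obtain ⟨p0, p1⟩ := h.p_mem n ω
      obtain ⟨l0, l1⟩ := h.l_mem n ω
      obtain ⟨i0, i1⟩ := I_mem ω
      constructor <;> nlinarith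
  have ibreg : ∀ n, Integrable
      (fun ω => (if γ < p n ω then 1 else 0) * ((p n ω - I ω) * l n ω)) μ := fun n =>
    (ireg n).bdd_mul (c := 1) (h.measurable_ite_const γ 1 0 n).aestronglyMeasurable
      (ae_of_all _ fun ω => by split_ifs <;> simp)
  have ipow : ∀ n, Integrable
      (fun ω => (if γ < p n ω then p n ω ^ (1 - α) else 0) * l n ω) μ := fun n =>
    integrable_of_mem_Icc (((h.meas_ite_rpow γ n (1 - α)).mono (F.le n) le_rfl).mul (ml n))
      (c := 0) (C := 1) fun ω => unitInterval.mul_mem (by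
        split_ifs
        · exact h.rpow_mem (by linarith) n ω
        · simp) (h.l_mem n ω)
  set low : ℕ → ℝ := fun n => ∫ ω, (if γ < p n ω then 0 else 1) * (p n ω * l n ω) ∂μ with hlow
  set bl : ℕ → ℝ := fun n => ∫ ω, (if γ < p n ω then 1 else 0) * l n ω ∂μ with hbl
  set pl : ℕ → ℝ := fun n => ∫ ω, p n ω * l n ω ∂μ with hpl
  -- Pointwise, `min p γ` is `p` on the low rounds and `γ` on the others, so one bound controls both
  -- sums.
  have hsum : ∑ n ∈ Finset.range T, low n + γ * ∑ n ∈ Finset.range T, bl n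
      ≤ 10 * Real.log T := by
    refine le_trans (le_of_eq ?_) hthr
    rw [Finset.mul_sum, ← Finset.sum_add_distrib]
    refine Finset.sum_congr rfl fun n _ => ?_
    simp only [hlow, hbl]
    rw [← integral_const_mul, ← integral_add (ilow n) ((ibl n).const_mul γ)]
    congr 1; ext ω
    split_ifs <;> ring
  have hlow0 : 0 ≤ ∑ n ∈ Finset.range T, low n := Finset.sum_nonneg fun n _ =>
    integral_nonneg fun ω => mul_nonneg (by split_ifs <;> simp)
      (mul_nonneg (h.p_mem n ω).1 (h.l_mem n ω).1)
  have hbl0 : 0 ≤ ∑ n ∈ Finset.range T, bl n := Finset.sum_nonneg fun n _ =>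
    integral_nonneg fun ω => (h.ite_mul_mem γ n ω).1
  have hblL : ∑ n ∈ Finset.range T, bl n ≤ 5 * L := by
    have e : γ * (5 * L) = 10 * Real.log T := by rw [hγ]; field_simp; ring
    have : γ * ∑ n ∈ Finset.range T, bl n ≤ γ * (5 * L) := by linarith
    exact le_of_mul_le_mul_left this hγ0
  have hlowL : ∑ n ∈ Finset.range T, low n ≤ 10 * Real.log T := by
    have := mul_nonneg hγ0.le hbl0
    linarith
  -- On low rounds the negative term `-1_A l` is simply dropped.
  have hround : ∀ n ∈ Finset.range T, ∫ ω, (p n ω - I ω) * l n ω ∂μ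
      ≤ low n + (lam / 2 * (D ^ α * pl n + D ^ (α - 1) * bl n)
        + 1 / lam * ∫ ω, drop p α γ n ω ∂μ) := by
    intro n hn
    have s1 : ∫ ω, (p n ω - I ω) * l n ω ∂μ ≤ low n
        + ∫ ω, (if γ < p n ω then 1 else 0) * ((p n ω - I ω) * l n ω) ∂μ := by
      simp only [hlow]
      rw [← integral_add (ilow n) (ibreg n)]
      refine integral_mono (ireg n) ((ilow n).add (ibreg n)) fun ω => ?_
      have := mul_nonneg (I_mem ω).1 (h.l_mem n ω).1
      simp only
      split_ifs
      · linarith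
      · linarith
    have s2 := h.integral_regret_le_drop h0 h1 hγ0 hlam (Finset.mem_range.1 hn)
    have s3 : ∫ ω, (if γ < p n ω then p n ω ^ (1 - α) else 0) * l n ω ∂μ
        ≤ D ^ α * pl n + D ^ (α - 1) * bl n := by
      simp only [hpl, hbl]
      rw [← integral_const_mul, ← integral_const_mul,
        ← integral_add ((ipl n).const_mul _) ((ibl n).const_mul _)]
      refine integral_mono (ipow n) (((ipl n).const_mul _).add ((ibl n).const_mul _)) fun ω => ?_
      have hDα : 0 ≤ D ^ α := Real.rpow_nonneg (by linarith) _
      have := rpow_one_sub_le h0 h1 (h.p_mem n ω).1 hD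
      have hl := (h.l_mem n ω).1
      simp only
      split_ifs
      · nlinarith
      · have := mul_nonneg hDα (mul_nonneg (h.p_mem n ω).1 hl)
        linarith
    have s4 := mul_le_mul_of_nonneg_left s3 (show 0 ≤ lam / 2 by linarith)
    linarith
  have hdrop : ∑ n ∈ Finset.range T, ∫ ω, drop p α γ n ω ∂μ
      ≤ (∫ ω, p 0 ω ^ α ∂μ - ∫ ω, p T ω ^ α ∂μ) / (α * (1 - α)) := by
    have hα : 0 < α * (1 - α) := mul_pos h0 (by linarith)
    rw [le_div_iff₀ hα, mul_comm, Finset.mul_sum, ← Finset.sum_range_sub'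
      (fun n => ∫ ω, p n ω ^ α ∂μ)]
    exact Finset.sum_le_sum fun n _ => h.integral_drop_le h0 h1 hγ0 n
  have hDα1 : 0 ≤ D ^ (α - 1) := Real.rpow_nonneg (by linarith) _
  calc _ ≤ _ := Finset.sum_le_sum hround
    _ = ∑ n ∈ Finset.range T, low n
        + (lam / 2 * (D ^ α * (∑ n ∈ Finset.range T, pl n)
            + D ^ (α - 1) * ∑ n ∈ Finset.range T, bl n)
          + 1 / lam * ∑ n ∈ Finset.range T, ∫ ω, drop p α γ n ω ∂μ) := by
        simp only [Finset.sum_add_distrib, Finset.mul_sum, mul_add]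
    _ ≤ _ := by
        have t1 := mul_le_mul_of_nonneg_left hdrop (show 0 ≤ 1 / lam by positivity)
        have t2 := mul_le_mul_of_nonneg_left (mul_le_mul_of_nonneg_left hblL hDα1)
          (show 0 ≤ lam / 2 by linarith)
        linarith

end ArmModel

/-! ### Solving the self-bounding inequality. -/

/-- Optimising the trade-off between the two terms of a regret bound. -/
lemma regret_tuning {R X H K L : ℝ} (hX : 0 < X) (hH : 0 ≤ H) (hL : 1 ≤ L) (hK : 0 ≤ K)
    (h : ∀ lam : ℝ, 0 < lam → R ≤ lam / 2 * (X * (R + L) + X * (5 * L)) + 1 / lam * H + K) :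
    R ≤ 8 * (Real.sqrt (H * X * L) + H * X) + 2 * K + 6 := by
  have hs0 := Real.sqrt_nonneg (H * X * L)
  have hHX : 0 ≤ H * X := by positivity
  rcases le_or_gt R 0 with hR | hR
  · linarith
  -- The constraint `lam X ≤ 1` lets the `R` on the right be absorbed as `R / 2`.
  have hmain : ∀ lam : ℝ, 0 < lam → lam * X ≤ 1 →
      R ≤ 6 * (lam * X * L) + 2 * (1 / lam * H) + 2 * K := by
    intro lam hl hlX
    have := h lam hl
    have : lam * X * R ≤ R := mul_le_of_le_one_left hR.le hlX
    linarith
  -- The optimal `lam` is `√(H / (X L)) = H / s`, admissible exactly when `H X ≤ L`. Otherwise `lam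
  -- = 1 / X` is used; when `H = 0`, `lam = 1 / (X L)` costs the additive 6.
  rcases hH.eq_or_lt with hH0 | hH0
  · have := hmain (1 / (X * L)) (by positivity) (by
      rw [div_mul_eq_mul_div, one_mul, div_le_one (by positivity)]; nlinarith)
    have e : 1 / (X * L) * X * L = 1 := by field_simp
    rw [e, ← hH0] at this
    linarith
  · rcases le_total L (H * X) with hc | hc
    · have := hmain (1 / X) (by positivity) (by field_simp; exact le_rfl)
      have e1 : 1 / X * X * L = L := by field_simp
      have e2 : 1 / (1 / X) * H = H * X := by rw [one_div_one_div, mul_comm]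
      rw [e1, e2] at this
      linarith
    · set s := Real.sqrt (H * X * L) with hs
      have hsp : 0 < s := Real.sqrt_pos.2 (by positivity)
      have hss : s * s = H * X * L := Real.mul_self_sqrt (by positivity)
      have hHs : H * X ≤ s := Real.le_sqrt_of_sq_le (by nlinarith)
      have := hmain (H / s) (by positivity) (by
        rw [div_mul_eq_mul_div, div_le_one hsp]; exact hHs)
      have e1 : H / s * X * L = s := by field_simp; linarith
      have e2 : 1 / (H / s) * H = s := by field_simp
      rw [e1, e2] at this
      linarith

/-! ### Pathwise facts about the game, and bounds on the entropy. -/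

section Game

variable {d T : ℕ} {Ω : Type*} {ν : Measure (LossSeq d T)}
  {best : LossSeq d T → Fin d} {ℓ : Ω → LossSeq d T} {a : Fin T → Ω → Fin d}

/-- The indicator that arm `i` is played in round `n`. -/
def playInd (a : Fin T → Ω → Fin d) (i : Fin d) (n : ℕ) (ω : Ω) : ℝ :=
  if h : n < T then (if a ⟨n, h⟩ ω = i then 1 else 0) else 0

/-- The loss of arm `i` in round `n`, truncated to `[0, 1]`. -/
noncomputable def truncLoss (ℓ : Ω → LossSeq d T) (i : Fin d) (n : ℕ) (ω : Ω) : ℝ :=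
  if h : n < T then max 0 (min 1 (ℓ ω ⟨n, h⟩ i)) else 0

lemma truncLoss_mem (ℓ : Ω → LossSeq d T) (i : Fin d) (n : ℕ) (ω : Ω) :
    truncLoss ℓ i n ω ∈ Set.Icc (0 : ℝ) 1 := by
  unfold truncLoss
  split_ifs
  · exact ⟨le_max_left _ _, max_le zero_le_one (min_le_left _ _)⟩
  · simp

lemma playInd_mem (a : Fin T → Ω → Fin d) (i : Fin d) (n : ℕ) (ω : Ω) :
    playInd a i n ω ∈ Set.Icc (0 : ℝ) 1 := by
  unfold playInd
  split_ifs <;> simp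

lemma IsOptimalArm.bestLoss_eq (hb : IsOptimalArm best) (l : LossSeq d T) :
    bestLoss l = armLoss l (best l) := by
  have : Nonempty (Fin d) := ⟨best l⟩
  exact le_antisymm (ciInf_le (Set.finite_range _).bddBelow _) (le_ciInf (hb.minimal l))

lemma truncLoss_eq {ω : Ω} (hω : ∀ t i, ℓ ω t i ∈ Set.Icc (0 : ℝ) 1) (i : Fin d) (t : Fin T) :
    truncLoss ℓ i t ω = ℓ ω t i := by
  simp [truncLoss, (hω t i).1, (hω t i).2]

lemma sum_truncLoss_eq {ω : Ω} (hω : ∀ t i, ℓ ω t i ∈ Set.Icc (0 : ℝ) 1) (i : Fin d) :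
    ∑ n ∈ Finset.range T, truncLoss ℓ i n ω = armLoss (ℓ ω) i := by
  rw [Finset.sum_range]
  exact Finset.sum_congr rfl fun t _ => truncLoss_eq hω i t

lemma sum_indicator_mul (best : LossSeq d T → Fin d) (ω : Ω) (f : Fin d → ℝ) :
    ∑ i, {ω | best (ℓ ω) = i}.indicator (fun _ => (1 : ℝ)) ω * f i = f (best (ℓ ω)) := by
  simp [Set.indicator_apply]

lemma priorArm_mem (hν : IsPrior ν) (i : Fin d) : priorArm ν best i ∈ Set.Icc (0 : ℝ) 1 := by
  have := hν.prob
  exact ⟨measureReal_nonneg, measureReal_le_one⟩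

/-- For `p > 0`, `p^(α-1) ≥ 1 - (1-α) log p ≥ 1 + (1-α)(1-p)`; multiply by `p`. -/
lemma sub_le_rpow_sub {α p : ℝ} (h1 : α < 1) (h : p ∈ Set.Icc (0 : ℝ) 1) :
    (1 - α) * (p * (1 - p)) ≤ p ^ α - p := by
  rcases h.1.eq_or_lt with h0 | h0
  · rw [← h0]
    have := Real.rpow_nonneg (le_refl (0 : ℝ)) α
    linarith
  · have e : p ^ α = p * p ^ (α - 1) := by
      rw [Real.rpow_sub_one h0.ne']; field_simp
    have h2 := Real.add_one_le_exp (Real.log p * (α - 1))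
    rw [← Real.rpow_def_of_pos h0] at h2
    have h3 := Real.log_le_sub_one_of_pos h0
    have : (1 - α) * (1 - p) ≤ p ^ (α - 1) - 1 := by nlinarith
    rw [e]
    nlinarith

/-- The left side bounds the regret of a single round, so this settles `T = 1` in part (1), where no
`log T` is available. -/
lemma sum_mul_one_sub_le_tsallis {α : ℝ} (h0 : 0 < α) (h1 : α < 1) {q : Fin d → ℝ}
    (hq : ∀ i, q i ∈ Set.Icc (0 : ℝ) 1) (hq1 : ∑ i, q i = 1) :
    ∑ i, q i * (1 - q i) ≤ tsallis α q := by
  have hs0 : 0 ≤ ∑ i, q i * (1 - q i) := Finset.sum_nonneg fun i _ =>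
    mul_nonneg (hq i).1 (by linarith [(hq i).2])
  have hs : (1 - α) * ∑ i, q i * (1 - q i) ≤ ∑ i, q i ^ α - 1 := by
    have e : ∑ i, q i ^ α - 1 = ∑ i, (q i ^ α - q i) := by rw [Finset.sum_sub_distrib, hq1]
    rw [Finset.mul_sum, e]
    exact Finset.sum_le_sum fun i _ => sub_le_rpow_sub h1 (hq i)
  rw [tsallis, le_div_iff₀ (mul_pos h0 (by linarith))]
  refine le_trans ?_ hs
  have := mul_nonneg (show 0 ≤ 1 - α by linarith) hs0
  nlinarith

lemma tsallis_nonneg {α : ℝ} (h0 : 0 < α) (h1 : α < 1) {q : Fin d → ℝ}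
    (hq : ∀ i, q i ∈ Set.Icc (0 : ℝ) 1) (hq1 : ∑ i, q i = 1) : 0 ≤ tsallis α q :=
  (Finset.sum_nonneg fun i _ => mul_nonneg (hq i).1 (by linarith [(hq i).2])).trans
    (sum_mul_one_sub_le_tsallis h0 h1 hq hq1)

/-- `rpow_one_sub_le` with `1 - α` in place of `α` gives `∑ q^α ≤ 2 d^(1-α)`. This turns the entropy
bound into the prior-free one. -/
lemma tsallis_mul_rpow_le {α : ℝ} (h0 : 0 < α) (h1 : α < 1) (hd : 1 ≤ d) {q : Fin d → ℝ}
    (hq : ∀ i, q i ∈ Set.Icc (0 : ℝ) 1) (hq1 : ∑ i, q i = 1) :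
    tsallis α q * (d : ℝ) ^ α ≤ 2 * d / (α * (1 - α)) := by
  have hα : 0 < α * (1 - α) := mul_pos h0 (by linarith)
  have hd' : (1 : ℝ) ≤ d := by exact_mod_cast hd
  have hd0 : (0 : ℝ) < d := by linarith
  have hX : 0 < (d : ℝ) ^ α := Real.rpow_pos_of_pos hd0 _
  have hs : ∑ i, q i ^ α ≤ 2 * (d : ℝ) ^ (1 - α) := by
    have hb : ∀ i, q i ^ α ≤ (d : ℝ) ^ (1 - α) * q i + (d : ℝ) ^ (-α) := fun i => by
      have := rpow_one_sub_le (α := 1 - α) (by linarith) (by linarith) (hq i).1 hd'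
      simpa using this
    refine (Finset.sum_le_sum fun i _ => hb i).trans (le_of_eq ?_)
    have e : (d : ℝ) ^ (1 - α) = d * (d : ℝ) ^ (-α) := by
      rw [sub_eq_add_neg, Real.rpow_add hd0, Real.rpow_one]
    rw [Finset.sum_add_distrib, ← Finset.mul_sum, hq1, Finset.sum_const, Finset.card_univ,
      Fintype.card_fin, nsmul_eq_mul, ← e]
    ring
  rw [tsallis, div_mul_eq_mul_div, div_le_div_iff_of_pos_right hα]
  have e : (d : ℝ) ^ (1 - α) * (d : ℝ) ^ α = d := by
    rw [← Real.rpow_add hd0]; simp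
  nlinarith

/-! ### Reduction of the game to its arms. -/

variable [MeasurableSpace Ω] {μ : Measure Ω}

lemma measurable_observation (hℓ : Measurable ℓ) (ha : ∀ t, Measurable (a t)) (t : Fin T) :
    Measurable (fun ω => (a t ω, ℓ ω t (a t ω))) := by
  refine (ha t).prodMk ?_
  have e : (fun ω => ℓ ω t (a t ω)) = fun ω => ∑ i, if a t ω = i then ℓ ω t i else 0 := by
    ext ω; simp
  rw [e]
  refine Finset.measurable_fun_sum _ fun i _ => Measurable.ite ?_ ?_ measurable_const
  · exact ha t (measurableSet_singleton i)
  · exact (measurable_pi_apply i).comp ((measurable_pi_apply t).comp hℓ)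

/-- The player's information after `n` rounds. -/
def playerFiltration (hℓ : Measurable ℓ) (ha : ∀ t, Measurable (a t)) :
    Filtration ℕ (inferInstance : MeasurableSpace Ω) where
  seq n := ⨆ (s : Fin T) (_ : s.val < n),
    MeasurableSpace.comap (fun ω => (a s ω, ℓ ω s (a s ω))) inferInstance
  mono' _ _ hnm := iSup₂_mono' fun s hs => ⟨s, lt_of_lt_of_le hs hnm, le_rfl⟩
  le' _ := iSup₂_le fun s _ => (measurable_observation hℓ ha s).comap_le

/-- The losses together with the player's information after `n` rounds. -/
def adversaryFiltration (hℓ : Measurable ℓ) (ha : ∀ t, Measurable (a t)) :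
    Filtration ℕ (inferInstance : MeasurableSpace Ω) where
  seq n := MeasurableSpace.comap ℓ inferInstance ⊔ playerFiltration hℓ ha n
  mono' _ _ hnm := sup_le_sup_left ((playerFiltration hℓ ha).mono hnm) _
  le' n := sup_le hℓ.comap_le ((playerFiltration hℓ ha).le n)

/-- All arms share the same two filtrations. The posterior is replaced by a version with values in
`[0, 1]` everywhere, also defined after the last round. -/
lemma IsThompsonSampling.exists_armModel (h : IsThompsonSampling μ ν best ℓ a)
    (hb : Measurable best) (i : Fin d) :
    ∃ p : ℕ → Ω → ℝ, ArmModel μ (playerFiltration h.measurable_loss h.measurable_arm)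
      (adversaryFiltration h.measurable_loss h.measurable_arm) T {ω | best (ℓ ω) = i} p
      (playInd a i) (truncLoss ℓ i) := by
  have := h.prob
  have hℓ := h.measurable_loss
  have ha := h.measurable_arm
  have mA : MeasurableSet {ω | best (ℓ ω) = i} :=
    (hb.comp hℓ) (measurableSet_singleton i)
  have mI : Measurable ({ω | best (ℓ ω) = i}.indicator (fun _ => (1 : ℝ))) :=
    measurable_const.indicator mA
  choose p mp p_mem hp using fun n => exists_condExp_version
    ((playerFiltration hℓ ha).le n) (μ := μ) mI (ArmModel.ind_mem _)
  refine ⟨p, fun n => le_sup_right, ?_, mp, p_mem, hp, fun n => ?_, truncLoss_mem ℓ i,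
    fun n => ?_, playInd_mem a i, fun n => ?_, fun n hn => ?_⟩
  · exact (le_sup_left : MeasurableSpace.comap ℓ inferInstance ≤ _) _
      ⟨{l | best l = i}, hb (measurableSet_singleton i), rfl⟩
  · unfold truncLoss
    split_ifs with hn
    · have m1 : Measurable (fun l : LossSeq d T => max 0 (min 1 (l ⟨n, hn⟩ i))) :=
        measurable_const.max (measurable_const.min
          ((measurable_pi_apply i).comp (measurable_pi_apply (⟨n, hn⟩ : Fin T))))
      exact (m1.comp (comap_measurable ℓ)).mono
        (le_sup_left : MeasurableSpace.comap ℓ inferInstance ≤ _) le_rfl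
    · exact measurable_const
  · unfold playInd
    split_ifs with hn
    · exact Measurable.ite (ha _ (measurableSet_singleton i)) measurable_const measurable_const
    · exact measurable_const
  · unfold playInd truncLoss
    split_ifs with hn
    -- Bandit feedback suffices here: the product is a function of the observed pair, since it
    -- vanishes unless arm `i` is played.
    · have m1 : Measurable (fun q : Fin d × ℝ => if q.1 = i then max 0 (min 1 q.2) else 0) :=
        Measurable.ite (measurable_fst (measurableSet_singleton i))
          (measurable_const.max (measurable_const.min measurable_snd)) measurable_const
      have m2 := m1.comp (comap_measurable
        (fun ω => (a ⟨n, hn⟩ ω, ℓ ω ⟨n, hn⟩ (a ⟨n, hn⟩ ω))))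
      have e : (fun ω => (if a ⟨n, hn⟩ ω = i then (1 : ℝ) else 0)
          * max 0 (min 1 (ℓ ω ⟨n, hn⟩ i))) =
          (fun q : Fin d × ℝ => if q.1 = i then max 0 (min 1 q.2) else 0) ∘
            (fun ω => (a ⟨n, hn⟩ ω, ℓ ω ⟨n, hn⟩ (a ⟨n, hn⟩ ω))) := by
        ext ω
        by_cases hai : a ⟨n, hn⟩ ω = i
        · simp [hai]
        · simp [hai]
      rw [e]
      exact m2.mono (le_iSup₂_of_le (f := fun (s : Fin T) (_ : s.val < n + 1) =>
        MeasurableSpace.comap (fun ω => (a s ω, ℓ ω s (a s ω))) inferInstance)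
        ⟨n, hn⟩ n.lt_succ_self le_rfl) le_rfl
    · simp only [zero_mul]
      exact measurable_const
  · have hs := h.sample ⟨n, hn⟩ i
    have e : playInd a i n = fun ω => if a ⟨n, hn⟩ ω = i then (1 : ℝ) else 0 := by
      ext ω; simp [playInd, hn]
    have e' : (fun ω => if best (ℓ ω) = i then (1 : ℝ) else 0)
        = {ω | best (ℓ ω) = i}.indicator (fun _ => (1 : ℝ)) := by
      ext ω; simp [Set.indicator_apply]
    rw [e]
    -- For `n < T` the filtrations unfold to `history` and `fullHistory` at round `n`.
    refine hs.trans ?_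
    unfold posteriorArm
    rw [e']
    exact hp n

lemma IsThompsonSampling.ae_mem_cube (h : IsThompsonSampling μ ν best ℓ a) (hν : IsPrior ν) :
    ∀ᵐ ω ∂μ, ∀ t i, ℓ ω t i ∈ Set.Icc (0 : ℝ) 1 := by
  have := hν.mem_cube
  rw [← h.law_loss] at this
  exact ae_of_ae_map h.measurable_loss.aemeasurable this

lemma integrable_indicator_mul_truncLoss [IsProbabilityMeasure μ] (hℓ : Measurable ℓ)
    (hb : Measurable best) (i : Fin d) (n : ℕ) :
    Integrable (fun ω => {ω | best (ℓ ω) = i}.indicator (fun _ => (1 : ℝ)) ω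
      * truncLoss ℓ i n ω) μ := by
  refine integrable_of_mem_Icc ?_ fun ω =>
    unitInterval.mul_mem (ArmModel.ind_mem _ ω) (truncLoss_mem ℓ i n ω)
  refine (measurable_const.indicator ((hb.comp hℓ) (measurableSet_singleton i))).mul ?_
  unfold truncLoss
  split_ifs with hn
  · exact measurable_const.max (measurable_const.min ((measurable_pi_apply i).comp
      ((measurable_pi_apply (⟨n, hn⟩ : Fin T)).comp hℓ)))
  · exact measurable_const

/-- The expected regret is the sum of the regrets of the arms. -/
lemma IsThompsonSampling.expectedRegret_eq (h : IsThompsonSampling μ ν best ℓ a)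
    (hν : IsPrior ν) (hb : IsOptimalArm best) {F G : Filtration ℕ ‹MeasurableSpace Ω›}
    {p : Fin d → ℕ → Ω → ℝ}
    (hp : ∀ i, ArmModel μ F G T {ω | best (ℓ ω) = i} (p i) (playInd a i) (truncLoss ℓ i)) :
    expectedRegret μ ℓ a = ∑ i, ∑ n ∈ Finset.range T, ∫ ω, (p i n ω
      - {ω | best (ℓ ω) = i}.indicator (fun _ => (1 : ℝ)) ω) * truncLoss ℓ i n ω ∂μ := by
  have := h.prob
  have ixl : ∀ i n, Integrable (fun ω => truncLoss ℓ i n ω * playInd a i n ω) μ := fun i n =>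
    integrable_of_mem_Icc (((hp i).measurable_l n).mul ((hp i).meas_x n)) fun ω =>
      unitInterval.mul_mem (truncLoss_mem ℓ i n ω) (playInd_mem a i n ω)
  have ipl : ∀ i n, Integrable (fun ω => truncLoss ℓ i n ω * p i n ω) μ := fun i n =>
    integrable_of_mem_Icc (((hp i).measurable_l n).mul ((hp i).measurable_p n)) fun ω =>
      unitInterval.mul_mem (truncLoss_mem ℓ i n ω) ((hp i).p_mem n ω)
  have iIl := integrable_indicator_mul_truncLoss (μ := μ) h.measurable_loss hb.measurable
  have e : ∀ i, ∀ n ∈ Finset.range T, ∫ ω, (p i n ω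
      - {ω | best (ℓ ω) = i}.indicator (fun _ => (1 : ℝ)) ω) * truncLoss ℓ i n ω ∂μ
      = ∫ ω, (truncLoss ℓ i n ω * playInd a i n ω
        - {ω | best (ℓ ω) = i}.indicator (fun _ => (1 : ℝ)) ω * truncLoss ℓ i n ω) ∂μ := by
    intro i n hn
    rw [integral_sub (ixl i n) (iIl i n), (hp i).integral_mul_x (Finset.mem_range.1 hn)
      ((hp i).meas_l n) (C := 1) fun ω => by
        rw [abs_of_nonneg (truncLoss_mem ℓ i n ω).1]; exact (truncLoss_mem ℓ i n ω).2,
      ← integral_sub (ipl i n) (iIl i n)]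
    congr 1; ext ω; ring
  have hI : ∀ i n, Integrable (fun ω => truncLoss ℓ i n ω * playInd a i n ω
        - {ω | best (ℓ ω) = i}.indicator (fun _ => (1 : ℝ)) ω * truncLoss ℓ i n ω) μ :=
    fun i n => (ixl i n).sub (iIl i n)
  rw [Finset.sum_congr rfl fun i _ => Finset.sum_congr rfl (e i)]
  simp_rw [← integral_finsetSum _ fun n _ => hI _ n]
  rw [← integral_finsetSum _ fun i _ => integrable_finsetSum _ fun n _ => hI i n]
  refine integral_congr_ae ?_
  filter_upwards [h.ae_mem_cube hν] with ω hω
  rw [hb.bestLoss_eq, Finset.sum_comm, Finset.sum_range]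
  rw [armLoss, ← Finset.sum_sub_distrib]
  refine Finset.sum_congr rfl fun t _ => ?_
  rw [Finset.sum_sub_distrib, sum_indicator_mul best ω fun i => truncLoss ℓ i t ω,
    truncLoss_eq hω]
  congr 1
  simp [playInd, truncLoss_eq hω]

lemma IsThompsonSampling.ae_bestLoss_le (h : IsThompsonSampling μ ν best ℓ a)
    (hν : IsPrior ν) (hb : IsOptimalArm best) {Lbar : ℝ} (hL : ∀ᵐ l ∂ν, bestLoss l ≤ Lbar) :
    ∀ᵐ ω ∂μ, bestLoss (ℓ ω) ≤ min Lbar T := by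
  rw [← h.law_loss] at hL
  filter_upwards [h.ae_mem_cube hν, ae_of_ae_map h.measurable_loss.aemeasurable hL] with ω h1 h2
  refine le_min h2 ?_
  rw [hb.bestLoss_eq, armLoss]
  exact (Finset.sum_le_sum fun t _ => (h1 t _).2).trans (by simp)

lemma priorArm_eq (h : IsThompsonSampling μ ν best ℓ a) (hb : Measurable best) (i : Fin d) :
    priorArm ν best i = ∫ ω, {ω | best (ℓ ω) = i}.indicator (fun _ => (1 : ℝ)) ω ∂μ := by
  have mA : MeasurableSet {ω | best (ℓ ω) = i} :=
    (hb.comp h.measurable_loss) (measurableSet_singleton i)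
  rw [integral_indicator mA, setIntegral_const, smul_eq_mul, mul_one, priorArm, ← h.law_loss,
    show {l | best l = i} = best ⁻¹' {i} from rfl,
    map_measureReal_apply h.measurable_loss (hb (measurableSet_singleton i))]
  rfl

/-- Before the first round the player's σ-algebra is trivial, so conditioning reduces to the mean.
-/
lemma ae_eq_priorArm (h : IsThompsonSampling μ ν best ℓ a) (hb : Measurable best) {i : Fin d}
    {G : Filtration ℕ ‹MeasurableSpace Ω›} {p : ℕ → Ω → ℝ}
    (hp : ArmModel μ (playerFiltration h.measurable_loss h.measurable_arm) G T
      {ω | best (ℓ ω) = i} p (playInd a i) (truncLoss ℓ i)) :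
    p 0 =ᵐ[μ] fun _ => priorArm ν best i := by
  have := h.prob
  have hF : (playerFiltration h.measurable_loss h.measurable_arm) 0 = ⊥ := by
    change (⨆ (s : Fin T) (_ : s.val < 0), _) = _
    simp
  have := hp.p_eq 0
  rw [hF, condExp_bot, ← priorArm_eq h hb i] at this
  exact this.symm

lemma sum_priorArm (h : IsThompsonSampling μ ν best ℓ a) (hb : Measurable best) :
    ∑ i, priorArm ν best i = 1 := by
  have := h.prob
  have hi : ∀ i, Integrable ({ω | best (ℓ ω) = i}.indicator (fun _ => (1 : ℝ))) μ := fun i =>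
    integrable_of_mem_Icc (measurable_const.indicator
      ((hb.comp h.measurable_loss) (measurableSet_singleton i))) (ArmModel.ind_mem _)
  simp_rw [priorArm_eq h hb]
  rw [← integral_finsetSum _ fun i _ => hi i]
  have : ∀ ω, ∑ i, {ω | best (ℓ ω) = i}.indicator (fun _ => (1 : ℝ)) ω = 1 := fun ω => by
    simpa using sum_indicator_mul (ℓ := ℓ) best ω fun _ => 1
  simp [this]

/-! ### Regret bounds for the whole game. -/

/-- The regret of Thompson Sampling over a single round. -/
theorem IsThompsonSampling.expectedRegret_le_of_one {ℓ : Ω → LossSeq d 1}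
    {ν : Measure (LossSeq d 1)} {best : LossSeq d 1 → Fin d} {a : Fin 1 → Ω → Fin d}
    (h : IsThompsonSampling μ ν best ℓ a) (hν : IsPrior ν) (hb : IsOptimalArm best) :
    expectedRegret μ ℓ a ≤ ∑ i, priorArm ν best i * (1 - priorArm ν best i) := by
  have := h.prob
  choose p hp using h.exists_armModel hb.measurable
  rw [h.expectedRegret_eq hν hb hp]
  refine Finset.sum_le_sum fun i _ => ?_
  have q_mem := priorArm_mem (best := best) hν i
  set q := priorArm ν best i with hq
  set I : Ω → ℝ := {ω | best (ℓ ω) = i}.indicator (fun _ => (1 : ℝ)) with hI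
  have mI : Measurable I := ((hp i).meas_ind 0).mono (Filtration.le _ 0) le_rfl
  have I_mem : ∀ ω, I ω ∈ Set.Icc (0 : ℝ) 1 := ArmModel.ind_mem _
  have iI : Integrable I μ := integrable_of_mem_Icc mI I_mem
  have iq : Integrable (fun ω => q * (1 - I ω)) μ := ((integrable_const 1).sub iI).const_mul q
  have e : ∫ ω, q * (1 - I ω) ∂μ = q * (1 - q) := by
    have hqI : q = ∫ ω, I ω ∂μ := priorArm_eq h hb.measurable i
    rw [integral_const_mul, integral_sub (integrable_const 1) iI, ← hqI]
    simp
  rw [Finset.sum_range_one, ← e]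
  refine integral_mono_ae (integrable_of_mem_Icc ((((hp i).measurable_p 0).sub mI).mul
    ((hp i).measurable_l 0)) (c := -1) (C := 1) fun ω => ?_) iq ?_
  · obtain ⟨p0, p1⟩ := (hp i).p_mem 0 ω
    obtain ⟨l0, l1⟩ := truncLoss_mem ℓ i 0 ω
    obtain ⟨i0, i1⟩ := I_mem ω
    constructor <;> nlinarith
  -- Pointwise `(q - 1_A) l ≤ q (1 - 1_A)`: the left side is nonpositive on `A` and equals `q l ≤ q`
  -- off it.
  · filter_upwards [ae_eq_priorArm h hb.measurable (hp i)] with ω hω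
    obtain ⟨l0, l1⟩ := truncLoss_mem ℓ i 0 ω
    rw [hω]
    by_cases hA : ω ∈ {ω | best (ℓ ω) = i}
    · have : I ω = 1 := Set.indicator_of_mem hA _
      rw [this]
      nlinarith [q_mem.2]
    · have : I ω = 0 := Set.indicator_of_notMem hA _
      rw [this]
      nlinarith [q_mem.1]

/-- The regret of Thompson Sampling, for every value of the trade-off parameter `lam`. -/
theorem IsThompsonSampling.expectedRegret_le_tradeoff (h : IsThompsonSampling μ ν best ℓ a)
    (hν : IsPrior ν) (hb : IsOptimalArm best) {α lam L : ℝ} (h0 : 0 < α) (h1 : α < 1)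
    (hT : 2 ≤ T) (hd : 1 ≤ d) (hL : 1 ≤ L) (hLT : L ≤ T) (hlam : 0 < lam)
    (hbest : ∀ᵐ ω ∂μ, bestLoss (ℓ ω) ≤ L) :
    expectedRegret μ ℓ a ≤ lam / 2 * ((d : ℝ) ^ α * (expectedRegret μ ℓ a + L)
        + (d : ℝ) ^ α * (5 * L))
      + 1 / lam * tsallis α (priorArm ν best) + 10 * d * Real.log T := by
  have := h.prob
  have hd' : (1 : ℝ) ≤ d := by exact_mod_cast hd
  have hd0 : (0 : ℝ) < d := by linarith
  have hα : 0 < α * (1 - α) := mul_pos h0 (by linarith)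
  choose p hp using h.exists_armModel hb.measurable
  have hR := h.expectedRegret_eq hν hb hp
  have ipl : ∀ i n, Integrable (fun ω => p i n ω * truncLoss ℓ i n ω) μ := fun i n =>
    integrable_of_mem_Icc (((hp i).measurable_p n).mul ((hp i).measurable_l n)) fun ω =>
      unitInterval.mul_mem ((hp i).p_mem n ω) (truncLoss_mem ℓ i n ω)
  have iIl := integrable_indicator_mul_truncLoss (μ := μ) h.measurable_loss hb.measurable
  have hA : ∀ i, ∀ᵐ ω ∂μ, ω ∈ {ω | best (ℓ ω) = i} →
      ∑ n ∈ Finset.range T, truncLoss ℓ i n ω ≤ L := fun i => by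
    filter_upwards [h.ae_mem_cube hν, hbest] with ω hω hω' hi
    rw [sum_truncLoss_eq hω, ← show best (ℓ ω) = i from hi, ← hb.bestLoss_eq]
    exact hω'
  -- The total loss of the player is the regret plus `L*`; this makes the bound self-referential.
  have hP : ∑ i, ∑ n ∈ Finset.range T, ∫ ω, p i n ω * truncLoss ℓ i n ω ∂μ
      ≤ expectedRegret μ ℓ a + L := by
    have e : ∑ i, ∑ n ∈ Finset.range T, ∫ ω, p i n ω * truncLoss ℓ i n ω ∂μ
        = expectedRegret μ ℓ a + ∫ ω, ∑ i, ∑ n ∈ Finset.range T,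
          {ω | best (ℓ ω) = i}.indicator (fun _ => (1 : ℝ)) ω * truncLoss ℓ i n ω ∂μ := by
      rw [hR, integral_finsetSum _ fun i _ => integrable_finsetSum _ fun n _ => iIl i n,
        ← Finset.sum_add_distrib]
      refine Finset.sum_congr rfl fun i _ => ?_
      rw [integral_finsetSum _ fun n _ => iIl i n, ← Finset.sum_add_distrib]
      refine Finset.sum_congr rfl fun n _ => ?_
      simp_rw [sub_mul]
      rw [integral_sub (ipl i n) (iIl i n)]
      ring
    have e2 : ∫ ω, ∑ i, ∑ n ∈ Finset.range T,
        {ω | best (ℓ ω) = i}.indicator (fun _ => (1 : ℝ)) ω * truncLoss ℓ i n ω ∂μ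
        ≤ ∫ _, L ∂μ := by
      refine integral_mono_ae (integrable_finsetSum _ fun i _ =>
        integrable_finsetSum _ fun n _ => iIl i n) (integrable_const L) ?_
      filter_upwards [h.ae_mem_cube hν, hbest] with ω hω hω'
      simp_rw [← Finset.mul_sum]
      rw [sum_indicator_mul best ω fun i => ∑ n ∈ Finset.range T, truncLoss ℓ i n ω,
        sum_truncLoss_eq hω, ← hb.bestLoss_eq]
      exact hω'
    simp only [integral_const, probReal_univ, one_smul] at e2
    linarith
  -- The initial posterior is `p_1`. The final potential is at least 1 in mean because `p^α ≥ p`,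
  -- which yields the `-1` in the entropy.
  have hH : ∑ i, (∫ ω, p i 0 ω ^ α ∂μ - ∫ ω, p i T ω ^ α ∂μ) / (α * (1 - α))
      ≤ tsallis α (priorArm ν best) := by
    rw [← Finset.sum_div, tsallis, div_le_div_iff_of_pos_right hα, Finset.sum_sub_distrib]
    refine sub_le_sub (Finset.sum_le_sum fun i _ => ?_) ?_
    · refine le_of_eq ?_
      calc ∫ ω, p i 0 ω ^ α ∂μ = ∫ _, priorArm ν best i ^ α ∂μ := by
            refine integral_congr_ae ?_
            filter_upwards [ae_eq_priorArm h hb.measurable (hp i)] with ω hω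
            rw [hω]
        _ = _ := by simp
    · rw [← sum_priorArm h hb.measurable]
      refine Finset.sum_le_sum fun i _ => ?_
      have := (hp i).integral_mul_ind (n := T) (g := fun _ => (1 : ℝ)) measurable_const (C := 1)
        (by simp)
      simp only [one_mul] at this
      rw [priorArm_eq h hb.measurable i, this]
      refine integral_mono (integrable_of_mem_Icc ((hp i).measurable_p T) ((hp i).p_mem T))
        (integrable_of_mem_Icc (((hp i).measurable_p T).pow_const α) ((hp i).rpow_mem h0 T))
        fun ω => ?_
      exact Real.self_le_rpow_of_le_one ((hp i).p_mem T ω).1 ((hp i).p_mem T ω).2 h1.le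
  have harm := Finset.sum_le_sum fun i (_ : i ∈ (Finset.univ : Finset (Fin d))) =>
    (hp i).sum_integral_regret_le h0 h1 hlam hd' hL hLT hT (hA i)
  rw [← hR] at harm
  simp only [Finset.sum_add_distrib, ← Finset.mul_sum, Finset.sum_const, Finset.card_univ,
    Fintype.card_fin, nsmul_eq_mul] at harm
  have e : (d : ℝ) ^ (α - 1) * (5 * (d * L)) = (d : ℝ) ^ α * (5 * L) := by
    have : (d : ℝ) ^ α = (d : ℝ) ^ (α - 1) * d := by
      rw [← Real.rpow_add_one hd0.ne']; congr 1; ring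
    rw [this]; ring
  rw [e] at harm
  have hX : 0 ≤ (d : ℝ) ^ α := Real.rpow_nonneg hd0.le _
  have t1 := mul_le_mul_of_nonneg_left (mul_le_mul_of_nonneg_left hP hX)
    (show 0 ≤ lam / 2 by linarith)
  have t2 := mul_le_mul_of_nonneg_left hH (show 0 ≤ 1 / lam by positivity)
  linarith

lemma IsThompsonSampling.one_le_arms (h : IsThompsonSampling μ ν best ℓ a) : 1 ≤ d := by
  have := h.prob
  have : Nonempty Ω := μ.nonempty_of_neZero
  exact Fin.pos (best (ℓ (Classical.arbitrary Ω)))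

/-- The regret of Thompson Sampling over at least two rounds. -/
theorem IsThompsonSampling.expectedRegret_le (h : IsThompsonSampling μ ν best ℓ a)
    (hν : IsPrior ν) (hb : IsOptimalArm best) {α Lbar : ℝ} (h0 : 0 < α) (h1 : α < 1)
    (hT : 2 ≤ T) (hLbar : 0 < Lbar) (hL : ∀ᵐ l ∂ν, bestLoss l ≤ Lbar) :
    expectedRegret μ ℓ a ≤ 35 * (Real.sqrt (tsallis α (priorArm ν best) * (d : ℝ) ^ α * Lbar)
      + tsallis α (priorArm ν best) * (d : ℝ) ^ α + d * Real.log T) := by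
  have hd := h.one_le_arms
  have hd' : (1 : ℝ) ≤ d := by exact_mod_cast hd
  have hT' : (1 : ℝ) ≤ T := by exact_mod_cast (by omega : 1 ≤ T)
  have hlog := two_le_three_mul_log hT
  have hdlog : Real.log T ≤ d * Real.log T := le_mul_of_one_le_left (by linarith) hd'
  have hX : 0 < (d : ℝ) ^ α := Real.rpow_pos_of_pos (by linarith) _
  have hH := tsallis_nonneg h0 h1 (priorArm_mem (best := best) hν) (sum_priorArm h hb.measurable)
  set H := tsallis α (priorArm ν best) with hHdef
  set X := (d : ℝ) ^ α with hXdef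
  have hHX : 0 ≤ H * X := by positivity
  -- Clamping to `[1, T]` meets the hypotheses of the trade-off and costs at most one unit over
  -- `Lbar`.
  set L := max 1 (min Lbar T) with hLdef
  have hLL : L ≤ Lbar + 1 := max_le (by linarith) ((min_le_left _ _).trans (by linarith))
  have := regret_tuning hX hH (le_max_left 1 (min Lbar T))
    (show 0 ≤ 10 * d * Real.log T by linarith) fun lam hlam =>
    h.expectedRegret_le_tradeoff hν hb h0 h1 hT hd (le_max_left 1 (min Lbar T))
      (max_le hT' (min_le_right _ _)) hlam (by
        filter_upwards [h.ae_bestLoss_le hν hb hL] with ω hω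
        exact hω.trans (le_max_right _ _))
  -- That unit is removed by `√(HX) ≤ (HX + 1) / 2`. The constant 35 is the 20 in front of `d log T`
  -- plus 15 for the leftover additive 10, as `2 ≤ 3 log T`.
  have hs : Real.sqrt (H * X * L) ≤ Real.sqrt (H * X * Lbar) + (H * X + 1) / 2 := by
    have hs0 := Real.sqrt_nonneg (H * X * Lbar)
    have hss : Real.sqrt (H * X * Lbar) * Real.sqrt (H * X * Lbar) = H * X * Lbar :=
      Real.mul_self_sqrt (by positivity)
    refine Real.sqrt_le_iff.2 ⟨by positivity, ?_⟩
    have := mul_le_mul_of_nonneg_left hLL hHX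
    nlinarith [sq_nonneg (H * X - 1), mul_nonneg hs0 hHX]
  have := Real.sqrt_nonneg (H * X * Lbar)
  linarith

end Game

/-! ### Conclusion. -/

/-- For `x ≥ 1/4` the root is at least `1/2`; for smaller `x`, `log x ≤ -3/4`. This absorbs the
regret of a single round in part (2), however small the bound on `L*`. -/
lemma one_le_four_mul_sqrt_add_log_sq {x : ℝ} (hx : 0 < x) :
    1 ≤ 4 * (Real.sqrt x + Real.log x ^ 2) := by
  rcases le_total (1 / 4) x with h | h
  · have : 1 / 2 ≤ Real.sqrt x := Real.le_sqrt_of_sq_le (by norm_num; linarith)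
    nlinarith [sq_nonneg (Real.log x)]
  · have h1 := Real.log_le_sub_one_of_pos hx
    nlinarith [Real.sqrt_nonneg x]

end BanditTS

theorem mainTheorem7 :
    (∃ C : ℝ, 0 < C ∧ ∀ α : ℝ, 0 < α → α < 1 →
      ∀ (d T : ℕ), 1 ≤ T →
      ∀ (ν : Measure (BanditTS.LossSeq d T)), BanditTS.IsPrior ν →
      ∀ best : BanditTS.LossSeq d T → Fin d, BanditTS.IsOptimalArm best →
      ∀ Lbar : ℝ, 0 < Lbar → (∀ᵐ ℓ ∂ν, BanditTS.bestLoss ℓ ≤ Lbar) →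
      ∀ (Ω : Type*) [MeasurableSpace Ω] (μ : Measure Ω)
        (ℓ : Ω → BanditTS.LossSeq d T) (a : Fin T → Ω → Fin d),
        BanditTS.IsThompsonSampling μ ν best ℓ a →
        BanditTS.expectedRegret μ ℓ a ≤
          C * (Real.sqrt (BanditTS.tsallis α (BanditTS.priorArm ν best) * (d : ℝ) ^ α * Lbar)
            + BanditTS.tsallis α (BanditTS.priorArm ν best) * (d : ℝ) ^ α
            + d * Real.log Lbar ^ 2 + d * Real.log T)) ∧
    (∀ α : ℝ, 0 < α → α < 1 → ∃ C : ℝ, 0 < C ∧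
      ∀ (d T : ℕ), 1 ≤ T →
      ∀ (ν : Measure (BanditTS.LossSeq d T)), BanditTS.IsPrior ν →
      ∀ best : BanditTS.LossSeq d T → Fin d, BanditTS.IsOptimalArm best →
      ∀ Lbar : ℝ, 0 < Lbar → (∀ᵐ ℓ ∂ν, BanditTS.bestLoss ℓ ≤ Lbar) →
      ∀ (Ω : Type*) [MeasurableSpace Ω] (μ : Measure Ω)
        (ℓ : Ω → BanditTS.LossSeq d T) (a : Fin T → Ω → Fin d),
        BanditTS.IsThompsonSampling μ ν best ℓ a →
        BanditTS.expectedRegret μ ℓ a ≤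
          C * (Real.sqrt (d * Lbar) + d * Real.log Lbar ^ 2 + d * Real.log T)) := by
  constructor
  · refine ⟨35, by norm_num, ?_⟩
    intro α h0 h1 d T hT ν hν best hb Lbar hLbar hL Ω _ μ ℓ a h
    have hd' : (1 : ℝ) ≤ d := by exact_mod_cast h.one_le_arms
    have hq := BanditTS.priorArm_mem (best := best) hν
    have hq1 := BanditTS.sum_priorArm h hb.measurable
    have hH := BanditTS.tsallis_nonneg h0 h1 hq hq1
    have hlog2 : 0 ≤ (d : ℝ) * Real.log Lbar ^ 2 := by positivity
    rcases (show T = 1 ∨ 2 ≤ T by omega) with rfl | hT2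
    · have h2 := (h.expectedRegret_le_of_one hν hb).trans
        (BanditTS.sum_mul_one_sub_le_tsallis h0 h1 hq hq1)
      have h3 := le_mul_of_one_le_right hH (Real.one_le_rpow hd' h0.le)
      have h4 := Real.sqrt_nonneg
        (BanditTS.tsallis α (BanditTS.priorArm ν best) * (d : ℝ) ^ α * Lbar)
      simp only [Nat.cast_one, Real.log_one, mul_zero, add_zero]
      linarith
    · have := h.expectedRegret_le hν hb h0 h1 hT2 hLbar hL
      linarith
  · intro α h0 h1
    have hα : 0 < α * (1 - α) := mul_pos h0 (by linarith)
    -- The factor from `tsallis_mul_rpow_le`; being at least 1, it dominates its own square root.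
    obtain ⟨κ, hκ⟩ : ∃ κ, κ = 2 / (α * (1 - α)) := ⟨_, rfl⟩
    have hκ1 : 1 ≤ κ := by rw [hκ, le_div_iff₀ hα]; nlinarith
    refine ⟨140 * κ, by positivity, ?_⟩
    intro d T hT ν hν best hb Lbar hLbar hL Ω _ μ ℓ a h
    have hd' : (1 : ℝ) ≤ d := by exact_mod_cast h.one_le_arms
    have hq := BanditTS.priorArm_mem (best := best) hν
    have hq1 := BanditTS.sum_priorArm h hb.measurable
    have hlog2 : 0 ≤ (d : ℝ) * Real.log Lbar ^ 2 := by positivity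
    have hs0 := Real.sqrt_nonneg ((d : ℝ) * Lbar)
    rcases (show T = 1 ∨ 2 ≤ T by omega) with rfl | hT2
    · have h2 : BanditTS.expectedRegret μ ℓ a ≤ 1 := by
        refine (h.expectedRegret_le_of_one hν hb).trans ?_
        rw [← hq1]
        exact Finset.sum_le_sum fun i _ =>
          mul_le_of_le_one_right (hq i).1 (by linarith [(hq i).1])
      have h3 := BanditTS.one_le_four_mul_sqrt_add_log_sq hLbar
      have h4 : Real.sqrt Lbar ≤ Real.sqrt (d * Lbar) :=
        Real.sqrt_le_sqrt (le_mul_of_one_le_left hLbar.le hd')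
      have h5 : Real.log Lbar ^ 2 ≤ d * Real.log Lbar ^ 2 :=
        le_mul_of_one_le_left (sq_nonneg _) hd'
      simp only [Nat.cast_one, Real.log_one, mul_zero, add_zero]
      nlinarith
    · have h2 := h.expectedRegret_le hν hb h0 h1 hT2 hLbar hL
      have h3 : BanditTS.tsallis α (BanditTS.priorArm ν best) * (d : ℝ) ^ α ≤ κ * d := by
        refine (BanditTS.tsallis_mul_rpow_le h0 h1 h.one_le_arms hq hq1).trans (le_of_eq ?_)
        rw [hκ]; ring
      have h4 : Real.sqrt (BanditTS.tsallis α (BanditTS.priorArm ν best) * (d : ℝ) ^ α * Lbar)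
          ≤ κ * Real.sqrt (d * Lbar) := by
        refine Real.sqrt_le_iff.2 ⟨by positivity, ?_⟩
        rw [mul_pow, Real.sq_sqrt (by positivity)]
        have e1 := mul_le_mul_of_nonneg_right h3 hLbar.le
        have e2 : κ * (d * Lbar) ≤ κ ^ 2 * (d * Lbar) :=
          mul_le_mul_of_nonneg_right (by nlinarith) (by positivity)
        linarith
      have hlog := BanditTS.two_le_three_mul_log hT2
      have h5 : (d : ℝ) * κ * 2 ≤ d * κ * (3 * Real.log T) :=
        mul_le_mul_of_nonneg_left hlog (by positivity)
      have h6 : (d : ℝ) * Real.log T ≤ κ * (d * Real.log T) :=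
        le_mul_of_one_le_left (mul_nonneg (by linarith) (by linarith)) hκ1
      have h7 := mul_nonneg (show 0 ≤ κ by linarith) hlog2
      have h8 := mul_nonneg (show 0 ≤ κ by linarith) hs0
      have h9 := mul_nonneg (show 0 ≤ (d : ℝ) by linarith) (show 0 ≤ Real.log T by linarith)
      linarith
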